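/- All graphs are finite, simple and undirected. A graph $H$ is a depth-$r$ minor of $G$ if there are pairwise vertex-disjoint connected subgraphs $G_v\subseteq G$ ($v\in V(H)$) of radius at most $r$ such that whenever $uv\in E(H)$ there is an edge of $G$ between $G_u$ and $G_v$; and $\nabla_r(G)$ is the maximum of $|E(H)|/|V(H)|$ over all depth-$r$ minors $H$ of $G$. A class $\mathcal{C}$ of graphs has sub-logarithmic expansion if there is $f:\mathbb{N}\to\mathbb{N}$ with $f(r)\in o(\log r)$ and $\nabla_r(G)\le f(r)$ for all $G\in\mathcal{C}$ and all $r\in\mathbb{N}$. A set $D\subseteq V(G)$ is dominating if every vertex lies in $D$ or has a neighbour in $D$; $\gamma(G)$ is the minimum size of a dominating set; $D$ is a $c$-approximation (of a minimum dominating set) if it is dominating and $|D|\le c\cdot\gamma(G)$. Algorithms are deterministic algorithms in the LOCAL model: every vertex of the network $G$ starts knowing only its own identifier; in each synchronous round every vertex performs an arbitrary local computation, sends a message of arbitrary length to each neighbour, and receives one from each neighbour. A vertex terminates when it irrevocably declares whether it belongs to the computed set, and the number of rounds of the algorithm is the number of rounds until all vertices have terminated (every vertex takes part in all these rounds). The identifiers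 of an $n$-vertex graph are distinct elements of $\{1,\dots,n^k\}$, where $k\ge 1$ is a fixed integer; an algorithm has to succeed for all such choices of identifiers. $\log^* n$ denotes the iterated binary logarithm. **Corollary.** Let $\mathcal{C}$ be a class of graphs of sub-logarithmic expansion (and let $k\geq 1$ be fixed). There are constants $K_{\varepsilon,c}$, for $\varepsilon>0$ and $c\in\mathbb{R}$, depending only on $\varepsilon$ and $c$ (and on $\mathcal{C}$ and $k$), such that the following holds. Assume that some algorithm computes a $c$-approximation of a minimum dominating set on every graph $G\in\mathcal{C}$ in at most $t$ rounds, where $t=t(G)$ may be any function of the graph, for example of its number of vertices. Then there is an algorithm, with $\varepsilon$ as a parameter, which for every $\varepsilon>0$ computes a $(1+\varepsilon)$-approximation of a minimum dominating set on every $n$-vertex graph $G\in\mathcal{C}$ in at most $K_{\varepsilon,c}\cdot(t(G)+\log^* n+1)$ rounds, that is, in $\mathcal{O}_{\varepsilon,c}(t+\log^* n)$ rounds. -/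

import Mathlib

open scoped ENNReal

/-! ### Shallow minors and sub-logarithmic expansion -/

/-- `H` is a depth-`r` minor of `G`: there are pairwise vertex disjoint subgraphs `M w` of `G`,
one for each vertex `w` of `H`, each of radius at most `r` (so nonempty and connected, since
the radius of an empty or disconnected graph is `⊤`), such that any two adjacent vertices of `H`
have an edge of `G` between their subgraphs. -/
def IsShallowMinor {V W : Type*} (r : ℕ) (H : SimpleGraph W) (G : SimpleGraph V) : Prop :=
  ∃ M : W → G.Subgraph,
    (∀ u w, u ≠ w → Disjoint (M u).verts (M w).verts) ∧
    (∀ w, (M w).coe.radius ≤ (r : ℕ∞)) ∧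
    ∀ u w, H.Adj u w → ∃ x ∈ (M u).verts, ∃ y ∈ (M w).verts, G.Adj x y

/-- `∇_r(G)`: the maximum edge density `|E(H)| / |V(H)|` of a depth-`r` minor `H` of `G`.
(The graph without vertices contributes `0 / 0 = 0`.) -/
noncomputable def shallowDensity {V : Type*} (r : ℕ) (G : SimpleGraph V) : ℝ≥0∞ :=
  ⨆ (m : ℕ) (H : SimpleGraph (Fin m)) (_ : IsShallowMinor r H G),
    (H.edgeSet.ncard : ℝ≥0∞) / (m : ℝ≥0∞)

/-- A class of finite graphs, given by its members on the vertex sets `Fin n`.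
Closure under isomorphism is not required. -/
abbrev GraphClass : Type := (n : ℕ) → Set (SimpleGraph (Fin n))

/-- A class of graphs has sub-logarithmic expansion if `∇_r(G) ≤ f(r)` for all its members `G`
and all `r`, for some function `f` with `f(r) ∈ o(log r)`. -/
def GraphClass.SubLogExpansion (C : GraphClass) : Prop :=
  ∃ f : ℕ → ℕ,
    ((fun r : ℕ => (f r : ℝ)) =o[Filter.atTop] fun r : ℕ => Real.log (r : ℝ)) ∧
    ∀ (n : ℕ) (G : SimpleGraph (Fin n)), G ∈ C n →
      ∀ r : ℕ, shallowDensity r G ≤ (f r : ℝ≥0∞)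

/-! ### Dominating sets -/

/-- `D` dominates `G`: every vertex lies in `D` or has a neighbour in `D`. -/
def IsDominatingSet {V : Type*} (G : SimpleGraph V) (D : Finset V) : Prop :=
  ∀ v, v ∈ D ∨ ∃ u ∈ D, G.Adj u v

/-- `γ(G)`: the minimum size of a dominating set of the finite graph `G`. -/
noncomputable def dominationNumber {V : Type*} [Fintype V] (G : SimpleGraph V) : ℕ :=
  sInf {s : ℕ | ∃ D : Finset V, IsDominatingSet G D ∧ D.card = s}

/-- `D` is a `c`-approximation of a minimum dominating set of `G`. -/
def IsDominationApprox {V : Type*} [Fintype V] (c : ℝ) (G : SimpleGraph V)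
    (D : Finset V) : Prop :=
  IsDominatingSet G D ∧ (D.card : ℝ) ≤ c * (dominationNumber G : ℝ)

/-! ### The iterated logarithm -/

/-- `log* n`: how often `⌈log₂ ·⌉` has to be applied to `n` to reach a value at most `1`. -/
noncomputable def logStar (n : ℕ) : ℕ :=
  sInf {i : ℕ | (Nat.clog 2)^[i] n ≤ 1}

/-! ### The LOCAL model -/

/-- A deterministic algorithm in the LOCAL model, executed by every vertex, with a yes/no output
at each vertex. A vertex starts knowing nothing but its own identifier (in particular neither the
number of vertices nor its degree). In each round a vertex in state `s` sends the message
`send s j` to its neighbour with identifier `j`, and then updates its state by `receive`, from the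
messages that it gets, each one paired with the identifier of its sender. Message length and local
computation are unrestricted.

The vertex terminates, with output `b`, as soon as `output` of its state is `some b`. -/
structure LocalAlgorithm where
  State : Type
  Msg : Type
  init : ℕ → State
  send : State → ℕ → Msg
  receive : State → Set (ℕ × Msg) → State
  output : State → Option Bool

namespace LocalAlgorithm

/-- The state of every vertex after a number of communication rounds on the graph `G` with
identifiers `ids`. -/
def stateAfter (A : LocalAlgorithm) {V : Type*} (G : SimpleGraph V) (ids : V → ℕ) :
    ℕ → V → A.State
  | 0, v => A.init (ids v)
  | r + 1, v =>
      A.receive (A.stateAfter G ids r v)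
        {p | ∃ u, G.Adj v u ∧ p = (ids u, A.send (A.stateAfter G ids r u) (ids v))}

/-- On `G` with identifiers `ids`, all vertices terminate within `T` rounds, and the vertices with
output `true` are exactly those in `D`. The output of a vertex is irrevocable: it is the first one
that it declares. (A vertex that has declared its output still takes part in the rounds that are
performed until all vertices have done so.) -/
def OutputsWithin (A : LocalAlgorithm) {V : Type*} (G : SimpleGraph V) (ids : V → ℕ)
    (T : ℕ) (D : Finset V) : Prop :=
  ∀ v, ∃ r ≤ T, ∃ b : Bool,
    A.output (A.stateAfter G ids r v) = some b ∧
    (∀ s < r, A.output (A.stateAfter G ids s v) = none) ∧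
    (b = true ↔ v ∈ D)

end LocalAlgorithm

/-- Unique identifiers from `{1, …, n ^ k}` for the vertices of an `n`-vertex graph. -/
def ValidIds (k : ℕ) {n : ℕ} (ids : Fin n → ℕ) : Prop :=
  Function.Injective ids ∧ ∀ v, 1 ≤ ids v ∧ ids v ≤ n ^ k

/-- On every graph `G` with `n` vertices from the class `C`, and for all unique identifiers from
`{1, …, n ^ k}`, the algorithm computes a `c`-approximation of a minimum dominating set of `G`
within `T n G` rounds. -/
def LocalAlgorithm.ComputesApprox (A : LocalAlgorithm) (C : GraphClass) (k : ℕ) (c : ℝ)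
    (T : (n : ℕ) → SimpleGraph (Fin n) → ℕ) : Prop :=
  ∀ (n : ℕ) (G : SimpleGraph (Fin n)), G ∈ C n → ∀ ids : Fin n → ℕ, ValidIds k ids →
    ∃ D : Finset (Fin n), A.OutputsWithin G ids (T n G) D ∧ IsDominationApprox c G D

/-!
The algorithm turns a `c`-approximation `D` into a partition of the graph into clusters of bounded
radius with few links between them, and dominates each cluster optimally.

*Quality.* Each vertex joins the cell of a neighbour in `D`; the cells form a depth-1 minor. Let
`κ` be a clustering whose clusters are unions of cells, and let `W` be the number of ordered pairs
of adjacent cells in different clusters (`Network.crossing`). If `O` is a minimum dominating set,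
then a cluster is dominated by its vertices in `O` together with those of its cell centres that
have a link to another cluster. Hence dominating all clusters optimally costs at most `γ(G) + W`
vertices (`Network.card_clusterwiseDominating_le`), and it suffices to make `W` at most
`ε / c * |D| ≤ ε * γ(G)`.

*Merging.* Let `f r` bound the densities of the depth-`r` minors. Initially `W ≤ 2 * f 1 * |D|`. Consider the weighted graph of clusters of radius `R`.
Each threshold graph of the weights is a depth-`R` minor, so its number of edges is at most `f R`
times its number of non-isolated vertices; summing over the thresholds, the total weight is at most
`2 * f R` times the sum over the clusters `X` of the weight of the link from `X` to its heaviest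
neighbour (`Network.IsClustering.sum_weight_le`). The heaviest neighbours form a pseudoforest, in
which disjoint stars with a quarter of that weight are selected by the method of conditional
expectations, one colour class after the other (`sum_le_four_mul_sum_leaves`). Contracting the stars
decreases `W` by the factor `1 - 1 / (8 * f R)` and replaces `R` by `3 * R + 1`
(`Network.IsClustering.ncard_crossing_mergeStars`). After `i` steps the radius is at most `3 ^ (i+1)`,
so sub-logarithmic expansion gives `f R = O(i)`, the harmonic series diverges, and a constant number
of steps makes `W` as small as required (`Network.exists_prod_le`).

*Rounds.* The proper colouring needed for the selection must be found without knowledge of the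
number of vertices. A vertex `x` runs `logStar x` Cole–Vishkin steps in the pseudoforest restricted
to the vertices with the same value of `logStar`; that value is made part of the colour
(`forestColor`). The number of colours is `O(log* n)`, and so is the number of rounds of a merging
step (`Network.localAt_mergeStars`).

*Termination.* The vertices know neither `n` nor the number of rounds `t` of the given algorithm.
They collect their views and stop as soon as the view determines the output. It therefore suffices
to show that the output at each vertex of a network `N` is determined, among all networks, by the
view of a radius `T` that may depend on `N` (`Network.LocalAt`,
`LocalAlgorithm.viewAlgorithm_outputsWithin`).
-/

/-! ### Networks and their local views -/

/-- A finite network whose vertices are their own identifiers. Numbers outside `V` are isolated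
vertices of `G` and do not belong to the network. -/
structure Network where
  V : Finset ℕ
  G : SimpleGraph ℕ
  mem_of_adj : ∀ {a b}, G.Adj a b → a ∈ V

namespace Network

/-- The network of a graph on `Fin n` with identifiers `ids`. -/
def ofIds {n : ℕ} (G : SimpleGraph (Fin n)) (ids : Fin n → ℕ) (h : Function.Injective ids) :
    Network where
  V := Finset.univ.map ⟨ids, h⟩
  G := G.map (⟨ids, h⟩ : Fin n ↪ ℕ)
  mem_of_adj := by
    intro a b hab
    obtain ⟨u, v, -, rfl, rfl⟩ := (SimpleGraph.map_adj (⟨ids, h⟩ : Fin n ↪ ℕ) _ _ _).1 hab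
    simp

@[simp] lemma mem_ofIds {n : ℕ} {G : SimpleGraph (Fin n)} {ids : Fin n → ℕ}
    {h : Function.Injective ids} {x : ℕ} : x ∈ (ofIds G ids h).V ↔ ∃ u, ids u = x := by
  simp [ofIds]

lemma ofIds_adj {n : ℕ} {G : SimpleGraph (Fin n)} {ids : Fin n → ℕ}
    {h : Function.Injective ids} {x y : ℕ} :
    (ofIds G ids h).G.Adj x y ↔ ∃ u v, G.Adj u v ∧ ids u = x ∧ ids v = y :=
  SimpleGraph.map_adj (⟨ids, h⟩ : Fin n ↪ ℕ) _ _ _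

lemma ofIds_adj_ids {n : ℕ} {G : SimpleGraph (Fin n)} {ids : Fin n → ℕ}
    {h : Function.Injective ids} {u v : Fin n} :
    (ofIds G ids h).G.Adj (ids u) (ids v) ↔ G.Adj u v :=
  SimpleGraph.map_adj_apply (f := (⟨ids, h⟩ : Fin n ↪ ℕ))

lemma mem_of_adj' (N : Network) {a b : ℕ} (h : N.G.Adj a b) : b ∈ N.V := N.mem_of_adj h.symm

/-- `Agree N N' r x`: the vertex `x` cannot distinguish the networks `N` and `N'` within `r`
rounds of communication. -/
def Agree (N N' : Network) : ℕ → ℕ → Prop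
  | 0, x => x ∈ N.V ∧ x ∈ N'.V
  | r + 1, x => Agree N N' r x ∧ (∀ y, N.G.Adj x y ↔ N'.G.Adj x y) ∧
      ∀ y, N.G.Adj x y → Agree N N' r y

variable {N N' : Network}

lemma Agree.symm : ∀ {r : ℕ} {x : ℕ}, Agree N N' r x → Agree N' N r x
  | 0, _, h => ⟨h.2, h.1⟩
  | _ + 1, _, h => ⟨h.1.symm, fun y => (h.2.1 y).symm, fun y hy => (h.2.2 y ((h.2.1 y).2 hy)).symm⟩

lemma Agree.mono {r s : ℕ} (hrs : r ≤ s) {x : ℕ} (h : Agree N N' s x) : Agree N N' r x := by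
  induction s, hrs using Nat.le_induction with
  | base => exact h
  | succ s _ ih => exact ih h.1

lemma Agree.mem {r x : ℕ} (h : Agree N N' r x) : x ∈ N.V := (h.mono (Nat.zero_le r)).1

lemma Agree.adj_iff {r x : ℕ} (h : Agree N N' (r + 1) x) (y : ℕ) :
    N.G.Adj x y ↔ N'.G.Adj x y := h.2.1 y

lemma Agree.of_adj {r x y : ℕ} (h : Agree N N' (r + 1) x) (hy : N.G.Adj x y) :
    Agree N N' r y := h.2.2 y hy

end Network

/-- `ReachIn G S d x y`: some walk of length at most `d` inside the set `S` joins `x` to `y`. -/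
def ReachIn {V : Type*} (G : SimpleGraph V) (S : Set V) (d : ℕ) (x y : V) : Prop :=
  ∃ p : G.Walk x y, p.length ≤ d ∧ ∀ z ∈ p.support, z ∈ S

namespace ReachIn

variable {V : Type*} {G : SimpleGraph V} {S S' : Set V} {d e : ℕ} {x y z : V}

lemma refl (h : x ∈ S) (d : ℕ) : ReachIn G S d x x :=
  ⟨.nil, by simp, by simpa using h⟩

lemma mono (h : ReachIn G S d x y) (hd : d ≤ e) (hS : S ⊆ S') : ReachIn G S' e x y := by
  obtain ⟨p, hp, hs⟩ := h
  exact ⟨p, hp.trans hd, fun z hz => hS (hs z hz)⟩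

lemma symm (h : ReachIn G S d x y) : ReachIn G S d y x := by
  obtain ⟨p, hp, hs⟩ := h
  exact ⟨p.reverse, by simpa using hp, by simpa using hs⟩

lemma trans (h : ReachIn G S d x y) (h' : ReachIn G S e y z) : ReachIn G S (d + e) x z := by
  obtain ⟨p, hp, hs⟩ := h
  obtain ⟨q, hq, hs'⟩ := h'
  refine ⟨p.append q, by rw [SimpleGraph.Walk.length_append]; omega, fun z hz => ?_⟩
  rcases (SimpleGraph.Walk.mem_support_append_iff p q).1 hz with hz | hz
  exacts [hs z hz, hs' z hz]

lemma of_adj (h : G.Adj x y) (hx : x ∈ S) (hy : y ∈ S) : ReachIn G S 1 x y :=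
  ⟨h.toWalk, by simp, by simp [hx, hy]⟩

lemma right_mem (h : ReachIn G S d x y) : y ∈ S := by
  obtain ⟨p, -, hs⟩ := h
  exact hs y p.end_mem_support

end ReachIn

namespace Network

/-- `Near N d x y`: the vertices `x` and `y` have distance at most `d`. -/
abbrev Near (N : Network) (d x y : ℕ) : Prop := ReachIn N.G Set.univ d x y

lemma near_refl (N : Network) (d x : ℕ) : N.Near d x x := .refl (Set.mem_univ x) d

lemma near_of_adj {N : Network} {x y : ℕ} (h : N.G.Adj x y) : N.Near 1 x y :=
  .of_adj h (Set.mem_univ x) (Set.mem_univ y)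

variable {N N' : Network}

lemma Agree.of_walk {r : ℕ} {x y : ℕ} (p : N.G.Walk x y) :
    Agree N N' (r + p.length) x →
      Agree N N' r y ∧ ∃ q : N'.G.Walk x y, q.length = p.length := by
  induction p with
  | nil => exact fun h => ⟨h, .nil, rfl⟩
  | cons hxy p ih =>
    intro h
    obtain ⟨h1, q, hq⟩ := ih (h.of_adj hxy)
    exact ⟨h1, .cons ((h.adj_iff _).1 hxy) q, by simp [hq]⟩

lemma Agree.near {d r s x y : ℕ} (h : Agree N N' s x) (hy : N.Near d x y) (hs : r + d ≤ s) :
    Agree N N' r y := by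
  obtain ⟨p, hp, -⟩ := hy
  exact (Agree.of_walk p (h.mono (by omega))).1

/-- A quantity `L`, attached to the vertices of all networks, is determined on the network `N` by
the views of radius `T`. The radius may depend on `N`, but the other networks `N'` with the same
view are arbitrary. -/
def LocalAt {α : Type*} (N : Network) (T : ℕ) (L : Network → ℕ → α) : Prop :=
  ∀ N' x, Agree N N' T x → L N x = L N' x

lemma LocalAt.mono {α : Type*} {N : Network} {S T : ℕ} {L : Network → ℕ → α}
    (h : N.LocalAt S L) (hST : S ≤ T) : N.LocalAt T L :=
  fun N' x hx => h N' x (hx.mono hST)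

end Network

/-! ### The algorithm that collects views -/

/-- The type of views of radius `r`: an identifier, or a view of smaller radius together with the
identified views of the neighbours. -/
def View : ℕ → Type
  | 0 => ℕ
  | r + 1 => View r × Set (ℕ × View r)

namespace Network

/-- The view of radius `r` of a vertex. -/
def view (N : Network) : (r : ℕ) → ℕ → View r
  | 0, x => x
  | r + 1, x => (N.view r x, {p | N.G.Adj x p.1 ∧ p.2 = N.view r p.1})

variable {N N' : Network}

lemma agree_of_view_eq : ∀ {r x : ℕ}, x ∈ N.V → x ∈ N'.V → N.view r x = N'.view r x →
    Agree N N' r x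
  | 0, _, hx, hx', _ => ⟨hx, hx'⟩
  | r + 1, x, hx, hx', h => by
    have h1 : N.view r x = N'.view r x := congrArg Prod.fst h
    have h2 : {p : ℕ × View r | N.G.Adj x p.1 ∧ p.2 = N.view r p.1} =
        {p | N'.G.Adj x p.1 ∧ p.2 = N'.view r p.1} := congrArg Prod.snd h
    have key : ∀ y, N.G.Adj x y → N'.G.Adj x y ∧ N.view r y = N'.view r y := fun y hy =>
      (Set.ext_iff.1 h2 (y, N.view r y)).1 ⟨hy, rfl⟩
    refine ⟨agree_of_view_eq hx hx' h1, fun y => ⟨fun hy => (key y hy).1, fun hy => ?_⟩,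
      fun y hy => ?_⟩
    · exact ((Set.ext_iff.1 h2 (y, N'.view r y)).2 ⟨hy, rfl⟩).1
    · exact agree_of_view_eq (N.mem_of_adj' hy) (N'.mem_of_adj' (key y hy).1) (key y hy).2

end Network

namespace LocalAlgorithm

/-- On a network, every algorithm sends each vertex through states that depend on its view only. -/
lemma stateAfter_congr (A : LocalAlgorithm) {N N' : Network} :
    ∀ {r x : ℕ}, N.Agree N' r x → A.stateAfter N.G id r x = A.stateAfter N'.G id r x
  | 0, _, _ => rfl
  | r + 1, x, h => by
    have h1 := A.stateAfter_congr h.1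
    simp only [stateAfter, h1]
    congr 1
    ext p
    constructor
    · rintro ⟨u, hu, rfl⟩
      exact ⟨u, (h.adj_iff u).1 hu, by rw [A.stateAfter_congr (h.of_adj hu)]⟩
    · rintro ⟨u, hu, rfl⟩
      exact ⟨u, (h.adj_iff u).2 hu, by
        rw [A.stateAfter_congr (h.of_adj ((h.adj_iff u).2 hu))]⟩

lemma stateAfter_ofIds (A : LocalAlgorithm) {n : ℕ} (G : SimpleGraph (Fin n)) (ids : Fin n → ℕ)
    (h : Function.Injective ids) : ∀ (r : ℕ) (v : Fin n),
      A.stateAfter G ids r v = A.stateAfter (Network.ofIds G ids h).G id r (ids v)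
  | 0, _ => rfl
  | r + 1, v => by
    have ih := A.stateAfter_ofIds G ids h r
    simp only [stateAfter, ih]
    congr 1
    ext p
    constructor
    · rintro ⟨u, hu, rfl⟩
      exact ⟨ids u, Network.ofIds_adj_ids.2 hu, rfl⟩
    · rintro ⟨u, hu, rfl⟩
      obtain ⟨v', w, hvw, hv, rfl⟩ := Network.ofIds_adj.1 hu
      obtain rfl := h hv
      exact ⟨w, hvw, rfl⟩

open Classical in
/-- The algorithm in which every vertex collects its view, and declares its membership in `F` as
soon as all networks that are consistent with the view agree on it. -/
noncomputable def viewAlgorithm (F : Network → ℕ → Prop) : LocalAlgorithm where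
  State := Σ r, View r
  Msg := Σ r, View r
  init x := ⟨0, x⟩
  send s _ := s
  receive s M := ⟨s.1 + 1, (s.2, {p | (p.1, ⟨s.1, p.2⟩) ∈ M})⟩
  output s := if h : ∃ b : Bool, ∀ (N : Network) (x : ℕ), x ∈ N.V → N.view s.1 x = s.2 →
    (b = true ↔ F N x) then some h.choose else none

lemma stateAfter_viewAlgorithm (F : Network → ℕ → Prop) (N : Network) :
    ∀ r x : ℕ, (viewAlgorithm F).stateAfter N.G id r x = ⟨r, N.view r x⟩
  | 0, _ => rfl
  | r + 1, x => by
    have ih := stateAfter_viewAlgorithm F N r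
    simp only [stateAfter, ih]
    have : {p : ℕ × View r | (p.1, (⟨r, p.2⟩ : Σ r, View r)) ∈
        {p : ℕ × (Σ r, View r) | ∃ u, N.G.Adj x u ∧ p = (u, ⟨r, N.view r u⟩)}} =
        {p | N.G.Adj x p.1 ∧ p.2 = N.view r p.1} := by
      ext ⟨y, w⟩
      simp only [Set.mem_ofPred_eq, Prod.mk.injEq]
      constructor
      · rintro ⟨u, hu, rfl, hw⟩
        exact ⟨hu, by simpa using hw⟩
      · rintro ⟨hy, rfl⟩
        exact ⟨y, hy, rfl, rfl⟩
    change (⟨r + 1, (N.view r x, _)⟩ : Σ r, View r) = ⟨r + 1, (N.view r x, _)⟩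
    rw [← this]
    rfl

/-- A set of vertices that is determined by views of radius `T` can be computed in `T` rounds,
even though the vertices do not know `T`. -/
theorem viewAlgorithm_outputsWithin {F : Network → ℕ → Prop} {n T : ℕ} {G : SimpleGraph (Fin n)}
    {ids : Fin n → ℕ} (h : Function.Injective ids)
    (hF : (Network.ofIds G ids h).LocalAt T F) {D : Finset (Fin n)}
    (hD : ∀ v, v ∈ D ↔ F (Network.ofIds G ids h) (ids v)) :
    (viewAlgorithm F).OutputsWithin G ids T D := by
  classical
  intro v
  set N := Network.ofIds G ids h with hN
  have hst : ∀ r, (viewAlgorithm F).stateAfter G ids r v = ⟨r, N.view r (ids v)⟩ := fun r => by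
    rw [stateAfter_ofIds _ _ _ h, stateAfter_viewAlgorithm]
  have hv : ids v ∈ N.V := by simp [hN]
  have hsome : ∀ r b, (viewAlgorithm F).output ⟨r, N.view r (ids v)⟩ = some b →
      (b = true ↔ F N (ids v)) := by
    intro r b hb
    simp only [viewAlgorithm] at hb
    split_ifs at hb with hex
    obtain rfl := Option.some.inj hb
    exact hex.choose_spec N _ hv rfl
  have hT : (viewAlgorithm F).output ⟨T, N.view T (ids v)⟩ ≠ none := by
    have hex : ∃ b : Bool, ∀ (N' : Network) (x : ℕ), x ∈ N'.V →
        N'.view T x = N.view T (ids v) → (b = true ↔ F N' x) := by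
      refine ⟨decide (F N (ids v)), fun N' x hx hview => ?_⟩
      have hid : ∀ (r : ℕ) (y : ℕ) , N'.view r x = N.view r y → x = y := by
        intro r
        induction r with
        | zero => exact fun y hy => hy
        | succ r ih => exact fun y hy => ih y (congrArg Prod.fst hy)
      obtain rfl := hid T _ hview
      rw [decide_eq_true_iff, hF N' _ (Network.agree_of_view_eq hv hx hview.symm)]
    simp only [viewAlgorithm, ne_eq]
    rw [dif_pos hex]
    simp
  have hex : ∃ r, (viewAlgorithm F).output ((viewAlgorithm F).stateAfter G ids r v) ≠ none :=
    ⟨T, by rw [hst]; exact hT⟩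
  have hle : Nat.find hex ≤ T := Nat.find_min' hex (by rw [hst]; exact hT)
  obtain ⟨b, hb⟩ := Option.ne_none_iff_exists'.1 (Nat.find_spec hex)
  refine ⟨Nat.find hex, hle, b, hb, fun s hs => by simpa using Nat.find_min hex hs, ?_⟩
  rw [hD]
  exact hsome _ _ (by rw [← hst]; exact hb)

/-- The vertices of a network at which the first declared output of `A` is `true`. -/
def outputSet (A : LocalAlgorithm) (N : Network) (x : ℕ) : Prop :=
  ∃ r, A.output (A.stateAfter N.G id r x) = some true ∧
    ∀ s < r, A.output (A.stateAfter N.G id s x) = none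

lemma OutputsWithin.mem_iff {A : LocalAlgorithm} {n T : ℕ} {G : SimpleGraph (Fin n)}
    {ids : Fin n → ℕ} (h : Function.Injective ids) {D : Finset (Fin n)}
    (hA : A.OutputsWithin G ids T D) (v : Fin n) :
    v ∈ D ↔ A.outputSet (Network.ofIds G ids h) (ids v) := by
  obtain ⟨r, -, b, hb, hlt, hbD⟩ := hA v
  simp only [outputSet, ← A.stateAfter_ofIds G ids h]
  rw [← hbD]
  constructor
  · rintro rfl
    exact ⟨r, hb, hlt⟩
  · rintro ⟨r', hr', hlt'⟩
    obtain hrr | rfl | hrr := lt_trichotomy r r'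
    · simp [hlt' r hrr] at hb
    · simpa [hb] using hr'
    · simp [hlt r' hrr] at hr'

/-- What an algorithm outputs within `T` rounds is determined by views of radius `T`. -/
lemma OutputsWithin.localAt {A : LocalAlgorithm} {n T : ℕ} {G : SimpleGraph (Fin n)}
    {ids : Fin n → ℕ} (h : Function.Injective ids) {D : Finset (Fin n)}
    (hA : A.OutputsWithin G ids T D) :
    (Network.ofIds G ids h).LocalAt T A.outputSet := by
  intro N' x hx
  obtain ⟨v, rfl⟩ := Network.mem_ofIds.1 hx.mem
  obtain ⟨r, hrT, b, hb, hlt, -⟩ := hA v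
  rw [A.stateAfter_ofIds G ids h] at hb
  simp only [A.stateAfter_ofIds G ids h] at hlt
  have hc : ∀ s ≤ r, A.stateAfter (Network.ofIds G ids h).G id s (ids v) =
      A.stateAfter N'.G id s (ids v) := fun s hs => A.stateAfter_congr (hx.mono (by omega))
  -- Both networks reach the first output at the same time `r`.
  have key : ∀ M : Network, A.output (A.stateAfter M.G id r (ids v)) = some b →
      (∀ s < r, A.output (A.stateAfter M.G id s (ids v)) = none) →
      (A.outputSet M (ids v) ↔ b = true) := by
    intro M hb hlt
    constructor
    · rintro ⟨r', hr', hlt'⟩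
      obtain hrr | rfl | hrr := lt_trichotomy r r'
      · simp [hlt' r hrr] at hb
      · simpa [hb] using hr'
      · simp [hlt r' hrr] at hr'
    · rintro rfl
      exact ⟨r, hb, hlt⟩
  rw [key _ hb hlt, key N' (by rw [← hc r le_rfl]; exact hb)
    fun s hs => by rw [← hc s hs.le]; exact hlt s hs]

end LocalAlgorithm

/-! ### Towers and the iterated logarithm -/

/-- The tower of twos of height `i`. -/
def tower : ℕ → ℕ
  | 0 => 1
  | i + 1 => 2 ^ tower i

lemma tower_pos : ∀ i, 0 < tower i
  | 0 => Nat.one_pos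
  | _ + 1 => Nat.two_pow_pos _

lemma lt_tower : ∀ i, i < tower i
  | 0 => Nat.one_pos
  | i + 1 => (Nat.succ_le_of_lt (lt_tower i)).trans_lt Nat.lt_two_pow_self

lemma tower_mono : Monotone tower :=
  monotone_nat_of_le_succ fun _ => Nat.lt_two_pow_self.le

lemma clog_iterate_le_one_iff {i n : ℕ} : (Nat.clog 2)^[i] n ≤ 1 ↔ n ≤ tower i := by
  induction i generalizing n with
  | zero => rfl
  | succ i ih =>
    rw [Function.iterate_succ_apply, ih, Nat.clog_le_iff_le_pow one_lt_two]
    rfl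

lemma logStar_le_iff {n i : ℕ} : logStar n ≤ i ↔ n ≤ tower i := by
  have hne : {i : ℕ | (Nat.clog 2)^[i] n ≤ 1}.Nonempty :=
    ⟨n, clog_iterate_le_one_iff.2 (lt_tower n).le⟩
  refine ⟨fun h => ?_, fun h => Nat.sInf_le (clog_iterate_le_one_iff.2 h)⟩
  exact (clog_iterate_le_one_iff.1 (Nat.sInf_mem hne)).trans (tower_mono h)

lemma tower_sq_le : ∀ i, tower i ^ 2 ≤ tower (i + 1)
  | 0 => by simp [tower]
  | i + 1 => by
    change (2 ^ tower i) ^ 2 ≤ 2 ^ 2 ^ tower i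
    rw [← pow_mul]
    refine Nat.pow_le_pow_right two_pos ?_
    obtain ⟨a, ha⟩ := Nat.exists_eq_succ_of_ne_zero (tower_pos i).ne'
    have := Nat.lt_two_pow_self (n := a)
    rw [ha, pow_succ]
    omega

lemma tower_pow_le (m k : ℕ) : tower m ^ k ≤ tower (m + k) := by
  induction k with
  | zero => exact (pow_zero _).le.trans (tower_pos m)
  | succ k ih =>
    calc tower m ^ (k + 1) = tower m ^ k * tower m := pow_succ _ _
      _ ≤ tower (m + k) * tower (m + k) := Nat.mul_le_mul ih (tower_mono (by omega))
      _ = tower (m + k) ^ 2 := (sq _).symm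
      _ ≤ tower (m + (k + 1)) := tower_sq_le _

lemma logStar_le_of_le_pow {x n k : ℕ} (h : x ≤ n ^ k) : logStar x ≤ logStar n + k :=
  logStar_le_iff.2 <| h.trans <|
    (Nat.pow_le_pow_left (logStar_le_iff.1 le_rfl) k).trans (tower_pow_le _ _)

/-! ### Colouring a pseudoforest by bit comparison -/

/-- The lowest position at which the binary expansions of `x` and `y` differ. -/
noncomputable def diffBit (x y : ℕ) : ℕ := sInf {i | x.testBit i ≠ y.testBit i}

/-- The Cole–Vishkin step: the new colour of a vertex of colour `x` with parent of colour `y`. -/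
noncomputable def bitStep (x y : ℕ) : ℕ := 2 * diffBit x y + (x.testBit (diffBit x y)).toNat

lemma testBit_diffBit_ne {x y : ℕ} (h : x ≠ y) :
    x.testBit (diffBit x y) ≠ y.testBit (diffBit x y) :=
  Nat.sInf_mem (s := {i | x.testBit i ≠ y.testBit i}) (Nat.exists_testBit_ne_of_ne h)

lemma bitStep_ne {x y z : ℕ} (h : x ≠ y) : bitStep x y ≠ bitStep y z := by
  intro he
  unfold bitStep at he
  have h1 := Bool.toNat_lt (x.testBit (diffBit x y))
  have h2 := Bool.toNat_lt (y.testBit (diffBit y z))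
  have h3 : diffBit x y = diffBit y z := by omega
  have h4 := testBit_diffBit_ne h
  rw [← h3] at he
  refine h4 ?_
  revert he
  cases x.testBit (diffBit x y) <;> cases y.testBit (diffBit x y) <;> simp

lemma bitStep_lt {x y m : ℕ} (h : x ≠ y) (hx : x < 2 ^ m) (hy : y < 2 ^ m) :
    bitStep x y < 2 * m := by
  have h1 := Bool.toNat_lt (x.testBit (diffBit x y))
  have h2 : diffBit x y < m := by
    by_contra hm
    have hp : 2 ^ m ≤ 2 ^ diffBit x y := Nat.pow_le_pow_right two_pos (not_lt.1 hm)
    exact testBit_diffBit_ne h (by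
      rw [Nat.testBit_lt_two_pow (hx.trans_le hp), Nat.testBit_lt_two_pow (hy.trans_le hp)])
  unfold bitStep
  omega

lemma bitStep_succ_lt (x : ℕ) : bitStep x (x + 1) < 2 := by
  have h1 := Bool.toNat_lt (x.testBit (diffBit x (x + 1)))
  have h2 : diffBit x (x + 1) ≤ 0 := Nat.sInf_le (by
    simp only [Set.mem_ofPred_eq, Nat.testBit_zero, ne_eq, decide_eq_decide]
    omega)
  unfold bitStep
  omega

/-- The colours after `j` Cole–Vishkin steps in the pseudoforest with parent function `p`, where
an edge is ignored if the iterated logarithms of its ends differ. A vertex without a parent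
pretends to have a parent whose colour is larger by one. -/
noncomputable def bitColor (p : ℕ → ℕ) : ℕ → ℕ → ℕ
  | 0, x => x
  | j + 1, x => bitStep (bitColor p j x)
      (if p x ≠ x ∧ logStar (p x) = logStar x then bitColor p j (p x) else bitColor p j x + 1)

lemma bitColor_ne (p : ℕ → ℕ) (j : ℕ) {x : ℕ} (hx : p x ≠ x) (hl : logStar (p x) = logStar x) :
    bitColor p j x ≠ bitColor p j (p x) := by
  induction j with
  | zero => exact hx.symm
  | succ j ih =>
    simp only [bitColor]
    rw [if_pos ⟨hx, hl⟩]
    exact bitStep_ne ih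

lemma bitColor_lt (p : ℕ → ℕ) : ∀ {i j x : ℕ}, logStar x = i + j →
    bitColor p j x < 16 * tower i
  | i, 0, x, h => by
    have h1 := logStar_le_iff.1 h.le
    have h2 := tower_pos i
    simp only [bitColor]
    simp only [add_zero] at h1
    omega
  | i, j + 1, x, h => by
    have hpos := tower_pos i
    have hpow : 16 * tower (i + 1) = 2 ^ (tower i + 4) := by
      rw [pow_add, mul_comm]; rfl
    simp only [bitColor]
    split_ifs with hp
    · have hx := bitColor_lt p (i := i + 1) (j := j) (x := x) (by omega)
      have hy := bitColor_lt p (i := i + 1) (j := j) (x := p x) (by omega)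
      rw [hpow] at hx hy
      have := bitStep_lt (bitColor_ne p j hp.1 hp.2) hx hy
      omega
    · have := bitStep_succ_lt (bitColor p j x)
      omega

/-- A colour for the vertices of the pseudoforest with parent function `p`. Vertices in the same
level of the iterated logarithm run the same number of Cole–Vishkin steps, so that the number of
vertices need not be known; the levels themselves separate the other pairs of vertices. -/
noncomputable def forestColor (p : ℕ → ℕ) (x : ℕ) : ℕ := 16 * logStar x + bitColor p (logStar x) x

lemma forestColor_lt (p : ℕ → ℕ) {x L : ℕ} (h : logStar x ≤ L) :
    forestColor p x < 16 * (L + 1) := by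
  have := bitColor_lt p (i := 0) (j := logStar x) (x := x) (by omega)
  simp only [tower] at this
  unfold forestColor
  omega

lemma forestColor_ne (p : ℕ → ℕ) {x : ℕ} (hx : p x ≠ x) :
    forestColor p x ≠ forestColor p (p x) := by
  have h1 := bitColor_lt p (i := 0) (j := logStar x) (x := x) (by omega)
  have h2 := bitColor_lt p (i := 0) (j := logStar (p x)) (x := p x) (by omega)
  simp only [tower] at h1 h2
  unfold forestColor
  intro h
  have hl : logStar (p x) = logStar x := by omega
  rw [hl] at h
  exact bitColor_ne p (logStar x) hx hl (by omega)

/-! ### Selecting stars by conditional expectations -/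

section Stars

variable (V : Finset ℕ) (p : ℕ → ℕ) (g : ℕ → ℕ) (col : ℕ → ℕ)

/-- If a vertex `X` is a star centre with probability `s X / 2`, independently, then four times
the expected total weight `g` of the vertices that are no centres but have a parent that is one is
affine in each `s Y`; `gain V p g s Y` is the slope. -/
def gain (s : ℕ → ℤ) (Y : ℕ) : ℤ :=
  ∑ X ∈ V with p X = Y, (g X : ℤ) * (2 - s X) - g Y * s (p Y)

/-- Derandomisation, one colour class after the other: after `j` rounds the vertices of colours
less than `j` have decided to be a centre (`2`) or not (`0`), all others are undecided (`1`). -/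
def select : ℕ → ℕ → ℤ
  | 0, _ => 1
  | j + 1, Y => if col Y = j then (if 0 ≤ gain V p g (select j) Y then 2 else 0) else select j Y

lemma select_of_le {j Y : ℕ} (h : j ≤ col Y) : select V p g col j Y = 1 := by
  induction j with
  | zero => rfl
  | succ j ih =>
    rw [select, if_neg (by omega), ih (by omega)]

lemma select_of_lt {j Y : ℕ} (h : col Y < j) :
    select V p g col j Y = select V p g col (col Y + 1) Y := by
  induction j, Nat.succ_le_of_lt h using Nat.le_induction with
  | base => rfl
  | succ j hj ih =>
    rw [select, if_neg (by omega), ih (by omega)]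

/-- The vertices that end up as star centres. -/
def IsCentre (Y : ℕ) : Prop := select V p g col (col Y + 1) Y = 2

lemma select_eq_zero {Y : ℕ} (h : ¬ IsCentre V p g col Y) :
    select V p g col (col Y + 1) Y = 0 := by
  unfold IsCentre at h
  simp only [select, if_true] at h ⊢
  split_ifs at h ⊢ <;> simp_all

variable {V p g col}

/-- No round of the derandomisation decreases the expected weight; the left-hand side is the initial
value, scaled by four. -/
lemma sum_select_le (hp : ∀ X ∈ V, p X ∈ V) (hg : ∀ X, p X = X → g X = 0)
    (hcol : ∀ X, p X ≠ X → col X ≠ col (p X)) (j : ℕ) :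
    ∑ X ∈ V, (g X : ℤ) ≤
      ∑ X ∈ V, (g X : ℤ) * (2 - select V p g col j X) * select V p g col j (p X) := by
  induction j with
  | zero => simp [select]
  | succ j ih =>
    refine ih.trans ?_
    set s := select V p g col j with hs
    set s' := select V p g col (j + 1) with hs'
    have hfib : ∑ X ∈ V, (g X : ℤ) * (2 - s X) * (s' (p X) - s (p X)) =
        ∑ Y ∈ V, (∑ X ∈ V with p X = Y, (g X : ℤ) * (2 - s X)) * (s' Y - s Y) := by
      rw [← Finset.sum_fiberwise_of_maps_to hp]
      refine Finset.sum_congr rfl fun Y _ => ?_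
      rw [Finset.sum_mul]
      refine Finset.sum_congr rfl fun X hX => ?_
      rw [(Finset.mem_filter.1 hX).2]
    -- Vertices of the same colour do not interact, so the expectation changes by the slopes.
    have key : ∑ X ∈ V, (g X : ℤ) * (2 - s' X) * s' (p X) -
        ∑ X ∈ V, (g X : ℤ) * (2 - s X) * s (p X) =
        ∑ Y ∈ V, gain V p g s Y * (s' Y - s Y) := by
      simp only [gain, sub_mul _ _ (_ - _ : ℤ)]
      rw [Finset.sum_sub_distrib, ← hfib, ← Finset.sum_sub_distrib, ← Finset.sum_sub_distrib]
      refine Finset.sum_congr rfl fun X _ => ?_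
      by_cases hX : p X = X
      · simp [hg X hX]
      · have h0 : s' X = s X ∨ s' (p X) = s (p X) := by
          by_contra! hne
          have hj : ∀ Y, s' Y ≠ s Y → col Y = j := fun Y hY => by
            by_contra hc
            exact hY (by rw [hs', select, if_neg hc])
          exact hcol X hX ((hj _ hne.1).trans (hj _ hne.2).symm)
        rcases h0 with h0 | h0 <;> rw [h0] <;> ring
    have hnn : 0 ≤ ∑ Y ∈ V, gain V p g s Y * (s' Y - s Y) := by
      refine Finset.sum_nonneg fun Y _ => ?_
      by_cases hY : col Y = j
      · have h1 : s Y = 1 := select_of_le V p g col hY.ge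
        have h2 : s' Y = if 0 ≤ gain V p g s Y then 2 else 0 := by
          rw [hs', select, if_pos hY]
        rw [h1, h2]
        split_ifs with h3 <;> linarith
      · have : s' Y = s Y := by rw [hs', select, if_neg hY]
        simp [this]
    linarith

/-- The leaves of the selected stars carry at least a quarter of the weight. -/
theorem sum_le_four_mul_sum_leaves [DecidablePred (IsCentre V p g col)]
    (hp : ∀ X ∈ V, p X ∈ V) (hg : ∀ X, p X = X → g X = 0)
    (hcol : ∀ X, p X ≠ X → col X ≠ col (p X)) :
    ∑ X ∈ V, g X ≤
      4 * ∑ X ∈ V with ¬ IsCentre V p g col X ∧ IsCentre V p g col (p X), g X := by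
  set m := V.sup col + 1 with hm
  have hlt : ∀ X ∈ V, col X < m := fun X hX => Nat.lt_succ_of_le (Finset.le_sup hX)
  have h := sum_select_le hp hg hcol m
  have hle : ∑ X ∈ V, (g X : ℤ) * (2 - select V p g col m X) * select V p g col m (p X) ≤
      ∑ X ∈ V, if ¬ IsCentre V p g col X ∧ IsCentre V p g col (p X) then 4 * (g X : ℤ) else 0 := by
    refine Finset.sum_le_sum fun X hX => ?_
    rw [select_of_lt V p g col (hlt X hX), select_of_lt V p g col (hlt _ (hp X hX))]
    by_cases h1 : IsCentre V p g col X
    · have : select V p g col (col X + 1) X = 2 := h1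
      simp [h1, this]
    · by_cases h2 : IsCentre V p g col (p X)
      · have : select V p g col (col (p X) + 1) (p X) = 2 := h2
        rw [select_eq_zero V p g col h1, this, if_pos ⟨h1, h2⟩]
        linarith
      · rw [select_eq_zero V p g col h2]
        simp [h2]
  have h4 := h.trans hle
  rw [← Finset.sum_filter, ← Finset.mul_sum] at h4
  exact_mod_cast h4

end Stars

/-! ### Merging clusters along stars -/

namespace Network

/-- `κ` maps each vertex to the centre of its cluster, and clusters are unions of the cells of the
finer clustering `κ₀`. Every vertex is joined to the centre by a walk of length at most `R` inside
the cluster. -/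
structure IsClustering (N : Network) (κ₀ κ : ℕ → ℕ) (R : ℕ) : Prop where
  reach : ∀ v, ReachIn N.G {z | κ z = κ v} R v (κ v)
  factor : ∀ v, κ (κ₀ v) = κ v

lemma Near.mem {N : Network} {d x y : ℕ} (h : N.Near d x y) (hx : x ∈ N.V) : y ∈ N.V := by
  obtain ⟨p, -, -⟩ := h
  induction p with
  | nil => exact hx
  | cons hxy p ih => exact ih (N.mem_of_adj' hxy)

namespace IsClustering

variable {N : Network} {κ₀ κ : ℕ → ℕ} {R : ℕ}

lemma near (h : N.IsClustering κ₀ κ R) (v : ℕ) : N.Near R v (κ v) :=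
  (h.reach v).mono le_rfl (Set.subset_univ _)

end IsClustering

section Merge

variable (N : Network) (κ₀ κ : ℕ → ℕ)

/-- The ordered pairs of adjacent cells of `κ₀` in the clusters `X ≠ Y` of `κ`. -/
def links (X Y : ℕ) : Set (ℕ × ℕ) :=
  {e | X ≠ Y ∧ ∃ u v, N.G.Adj u v ∧ κ u = X ∧ κ v = Y ∧ e = (κ₀ u, κ₀ v)}

/-- The number of pairs of adjacent cells in two different clusters. -/
noncomputable def weight (X Y : ℕ) : ℕ := (N.links κ₀ κ X Y).ncard

open Classical in
/-- Some `Y` that maximises `g`, or `X` if `g` has no positive maximum. -/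
noncomputable def heaviest (X : ℕ) (g : ℕ → ℕ) : ℕ :=
  if h : ∃ Y, 0 < g Y ∧ ∀ Z, g Z ≤ g Y then h.choose else X

/-- The cluster to which the cluster `X` has the largest weight, or `X` if `X` has no neighbour. -/
noncomputable def partner (X : ℕ) : ℕ := heaviest X (N.weight κ₀ κ X)

/-- The clusters that absorb others, selected in the pseudoforest of partners. -/
def IsStarCentre (X : ℕ) : Prop :=
  IsCentre N.V (N.partner κ₀ κ) (fun X => N.weight κ₀ κ X (N.partner κ₀ κ X))
    (forestColor (N.partner κ₀ κ)) X

open Classical in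
/-- The cluster into which the cluster `X` is merged. -/
noncomputable def mergeTarget (X : ℕ) : ℕ :=
  if ¬ N.IsStarCentre κ₀ κ X ∧ N.IsStarCentre κ₀ κ (N.partner κ₀ κ X) then N.partner κ₀ κ X else X

/-- The clustering after merging the leaves of all selected stars into their centres. -/
noncomputable def mergeStars (v : ℕ) : ℕ := N.mergeTarget κ₀ κ (κ v)

variable {N κ₀ κ}

lemma exists_adj_of_partner_ne {X : ℕ} (h : N.partner κ₀ κ X ≠ X) :
    ∃ u v, N.G.Adj u v ∧ κ u = X ∧ κ v = N.partner κ₀ κ X := by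
  unfold partner heaviest at h ⊢
  split_ifs at h ⊢ with hex
  · obtain ⟨e, -, u, v, huv, hu, hv, -⟩ := Set.nonempty_of_ncard_ne_zero hex.choose_spec.1.ne'
    exact ⟨u, v, huv, hu, hv⟩
  · exact absurd rfl h

lemma mergeTarget_partner {X : ℕ} (h : N.IsStarCentre κ₀ κ (N.partner κ₀ κ X)) :
    N.mergeTarget κ₀ κ (N.partner κ₀ κ X) = N.partner κ₀ κ X :=
  if_neg fun h' => h'.1 h

lemma IsClustering.mergeStars {R : ℕ} (h : N.IsClustering κ₀ κ R) :
    N.IsClustering κ₀ (N.mergeStars κ₀ κ) (3 * R + 1) where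
  factor v := by simp only [Network.mergeStars, h.factor]
  reach v := by
    have hsub : ∀ X Y, N.mergeTarget κ₀ κ X = Y →
        {z | κ z = X} ⊆ {z | N.mergeStars κ₀ κ z = Y} := by
      rintro X Y hXY z rfl
      exact hXY
    have hreach : ∀ z Y, N.mergeTarget κ₀ κ (κ z) = Y →
        ReachIn N.G {z | N.mergeStars κ₀ κ z = Y} R z (κ z) := fun z Y hz =>
      (h.reach z).mono le_rfl (hsub _ _ hz)
    by_cases hc : ¬ N.IsStarCentre κ₀ κ (κ v) ∧ N.IsStarCentre κ₀ κ (N.partner κ₀ κ (κ v))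
    · have hv : N.mergeTarget κ₀ κ (κ v) = N.partner κ₀ κ (κ v) := if_pos hc
      have hv' : N.mergeStars κ₀ κ v = N.partner κ₀ κ (κ v) := hv
      obtain ⟨u, w, huw, hu, hw⟩ := exists_adj_of_partner_ne (N := N) (κ₀ := κ₀) (κ := κ)
        (X := κ v) fun he => hc.1 (he ▸ hc.2)
      have hw' : N.mergeTarget κ₀ κ (κ w) = N.partner κ₀ κ (κ v) := by
        rw [hw, mergeTarget_partner hc.2]
      rw [hv']
      have h1 := hreach v _ hv
      have h2 := (hreach u (N.partner κ₀ κ (κ v)) (by rw [hu]; exact hv)).symm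
      have h3 := hreach w _ hw'
      rw [hu] at h2
      rw [hw] at h3
      have h4 : ReachIn N.G {z | N.mergeStars κ₀ κ z = N.partner κ₀ κ (κ v)} 1 u w :=
        .of_adj huw (hsub _ _ hv hu) (hsub _ _ hw' rfl)
      exact (((h1.trans h2).trans h4).trans h3).mono (by omega) subset_rfl
    · have hv : N.mergeTarget κ₀ κ (κ v) = κ v := if_neg hc
      have hv' : N.mergeStars κ₀ κ v = κ v := hv
      rw [hv']
      exact (hreach v _ hv).mono (by omega) subset_rfl

lemma IsClustering.near_partner {R : ℕ} (h : N.IsClustering κ₀ κ R) (X : ℕ) :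
    N.Near (2 * R + 1) X (N.partner κ₀ κ X) := by
  by_cases hX : N.partner κ₀ κ X = X
  · rw [hX]
    exact near_refl _ _ _
  · obtain ⟨u, v, huv, hu, hv⟩ := exists_adj_of_partner_ne hX
    have h1 := (h.near u).symm
    have h2 := h.near v
    rw [hu] at h1
    rw [hv] at h2
    exact ((h1.trans (near_of_adj huv)).trans h2).mono (by omega) subset_rfl

end Merge

/-! ### Locality of the merging step -/

section Locality

variable {N : Network} {P : Network → ℕ → ℕ} {ρ T : ℕ}

lemma localAt_bitColor (hP : ∀ M x, Near M ρ x (P M x)) (h : N.LocalAt T P) (j : ℕ) :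
    N.LocalAt (T + j * ρ) fun M => bitColor (P M) j := by
  induction j with
  | zero => exact fun _ _ _ => rfl
  | succ j ih =>
    intro N' x hx
    rw [Nat.succ_mul] at hx
    have h1 := h N' x (hx.mono (by omega))
    have h2 := ih N' x (hx.mono (by omega))
    have h3 := ih N' _ (hx.near (r := T + j * ρ) (hP N x) (by omega))
    simp only [bitColor]
    simp only at h2 h3
    rw [← h1, h2, h3]

lemma localAt_forestColor (hP : ∀ M x, Near M ρ x (P M x)) (h : N.LocalAt T P) {L : ℕ}
    (hL : ∀ x ∈ N.V, logStar x ≤ L) :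
    N.LocalAt (T + L * ρ) fun M => forestColor (P M) := by
  intro N' x hx
  have hle : logStar x * ρ ≤ L * ρ := Nat.mul_le_mul_right _ (hL x hx.mem)
  have := localAt_bitColor hP h (logStar x) N' x (hx.mono (by omega))
  simp only at this
  simp only [forestColor, this]

lemma localAt_select (hP : ∀ M x, Near M ρ x (P M x)) (h : N.LocalAt T P)
    {g col : Network → ℕ → ℕ} (hg : N.LocalAt T g) (hcol : N.LocalAt T col) (j : ℕ) :
    N.LocalAt (T + j * ρ) fun M => select M.V (P M) (g M) (col M) j := by
  induction j with
  | zero => exact fun _ _ _ => rfl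
  | succ j ih =>
    intro N' Y hY
    rw [Nat.succ_mul] at hY
    have hY0 := hY.mono (r := T) (by omega)
    have h1 := h N' Y hY0
    have h2 := ih N' Y (hY.mono (by omega))
    have h3 := ih N' _ (hY.near (r := T + j * ρ) (hP N Y) (by omega))
    have hset : {X ∈ N.V | P N X = Y} = {X ∈ N'.V | P N' X = Y} := by
      ext X
      simp only [Finset.mem_filter]
      constructor
      · rintro ⟨hX, rfl⟩
        have hXa := hY.near (r := T) (ReachIn.symm (hP N X)) (by omega)
        exact ⟨hXa.symm.mem, (h N' X hXa).symm⟩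
      · rintro ⟨hX, rfl⟩
        have hXa := (hY.symm.near (r := T) (ReachIn.symm (hP N' X)) (by omega)).symm
        exact ⟨hXa.mem, h N' X hXa⟩
    have hgain : gain N.V (P N) (g N) (select N.V (P N) (g N) (col N) j) Y =
        gain N'.V (P N') (g N') (select N'.V (P N') (g N') (col N') j) Y := by
      simp only at h3
      unfold gain
      rw [hset, ← h1, h3, hg N' Y hY0]
      congr 1
      refine Finset.sum_congr rfl fun X hX => ?_
      rw [← hset] at hX
      obtain ⟨-, rfl⟩ := Finset.mem_filter.1 hX
      have hXa := hY.near (r := T + j * ρ) (ReachIn.symm (hP N X)) (by omega)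
      have h4 := ih N' X hXa
      simp only at h4
      rw [h4, hg N' X (hXa.mono (by omega))]
    simp only [select] at h2 ⊢
    rw [hcol N' Y hY0, hgain, h2]

lemma localAt_isCentre (hP : ∀ M x, Near M ρ x (P M x)) (h : N.LocalAt T P)
    {g col : Network → ℕ → ℕ} (hg : N.LocalAt T g) (hcol : N.LocalAt T col) {m : ℕ}
    (hm : ∀ x ∈ N.V, col N x < m) :
    N.LocalAt (T + m * ρ) fun M => IsCentre M.V (P M) (g M) (col M) := by
  intro N' x hx
  have hle : (col N x + 1) * ρ ≤ m * ρ := Nat.mul_le_mul_right _ (hm x hx.mem)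
  have h1 := localAt_select hP h hg hcol (col N x + 1) N' x (hx.mono (by omega))
  simp only at h1
  simp only [IsCentre]
  rw [← hcol N' x (hx.mono (by omega)), h1]

variable {K₀ K : Network → ℕ → ℕ} {R : ℕ}

lemma localAt_weight (hK : ∀ M, IsClustering M (K₀ M) (K M) R) (h₀ : N.LocalAt T K₀)
    (h : N.LocalAt T K) :
    N.LocalAt (T + R + 1) fun M => M.weight (K₀ M) (K M) := by
  -- Each link of `X` comes from an edge with both ends within distance `R + 1` of `X`.
  have key : ∀ {M M' : Network}, (∀ y, Agree M M' T y → K₀ M y = K₀ M' y) →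
      (∀ y, Agree M M' T y → K M y = K M' y) → ∀ {X Y : ℕ}, Agree M M' (T + R + 1) X →
      M.links (K₀ M) (K M) X Y ⊆ M'.links (K₀ M') (K M') X Y := by
    rintro M M' h₀ h X Y hX e ⟨hne, u, v, huv, rfl, rfl, rfl⟩
    have hu := hX.near (r := T + 1) ((hK M).near u).symm (by omega)
    have hv := hu.of_adj huv
    have hu' := hu.mono (Nat.le_succ T)
    exact ⟨hne, u, v, (hu.adj_iff v).1 huv, (h _ hu').symm, (h _ hv).symm, by
      rw [h₀ _ hu', h₀ _ hv]⟩
  intro N' X hX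
  funext Y
  simp only [weight]
  congr 1
  exact (key (h₀ N') (h N') hX).antisymm
    (key (fun y hy => (h₀ N' y hy.symm).symm) (fun y hy => (h N' y hy.symm).symm) hX.symm)

/-- One merging step increases the radius of the views that determine the clustering by an amount
that is linear in the iterated logarithm of the identifiers. -/
theorem localAt_mergeStars (hK : ∀ M, IsClustering M (K₀ M) (K M) R) (h₀ : N.LocalAt T K₀)
    (h : N.LocalAt T K) {L : ℕ} (hL : ∀ x ∈ N.V, logStar x ≤ L) :
    N.LocalAt (T + 18 * (2 * R + 1) * (L + 1)) fun M => M.mergeStars (K₀ M) (K M) := by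
  classical
  set ρ := 2 * R + 1 with hρ
  have hw := localAt_weight hK h₀ h
  have hP : N.LocalAt (T + R + 1) fun M => M.partner (K₀ M) (K M) := fun N' x hx => by
    have := hw N' x hx
    simp only at this
    simp only [partner, this]
  have hnear : ∀ M x, Near M ρ x (M.partner (K₀ M) (K M) x) := fun M x => (hK M).near_partner x
  have hg : N.LocalAt (T + R + 1)
      fun M X => M.weight (K₀ M) (K M) X (M.partner (K₀ M) (K M) X) := fun N' x hx => by
    have h1 := hw N' x hx
    have h2 := hP N' x hx
    simp only at h1 h2
    simp only [h1, h2]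
  have hcol := localAt_forestColor hnear hP hL
  have hcen := localAt_isCentre hnear (hP.mono (T := T + R + 1 + L * ρ) (by omega))
    (hg.mono (by omega)) hcol (fun x hx => forestColor_lt _ (hL x hx))
  have hmul : 18 * ρ * (L + 1) = 16 * (L + 1) * ρ + L * ρ + ρ + ρ + L * ρ := by ring
  intro N' x hx
  have hxK := h N' x (hx.mono (by omega))
  have hX := hx.near (r := T + R + 1 + L * ρ + 16 * (L + 1) * ρ + ρ) ((hK N).near x) (by omega)
  have h1 := hP N' _ (hX.mono (by omega))
  have h2 := hcen N' _ (hX.mono (by omega))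
  have h3 := hcen N' _ (hX.near (hnear N _) le_rfl)
  change N.mergeTarget (K₀ N) (K N) (K N x) = N'.mergeTarget (K₀ N') (K N') (K N' x)
  rw [← hxK]
  have h2' : N.IsStarCentre (K₀ N) (K N) (K N x) ↔ N'.IsStarCentre (K₀ N') (K N') (K N x) :=
    iff_of_eq h2
  have h3' : N.IsStarCentre (K₀ N) (K N) (N.partner (K₀ N) (K N) (K N x)) ↔
      N'.IsStarCentre (K₀ N') (K N') (N.partner (K₀ N) (K N) (K N x)) := iff_of_eq h3
  simp only at h1
  exact if_congr (and_congr (not_congr h2') (h3'.trans (by rw [h1]))) h1 rfl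

end Locality

end Network

/-! ### Sparsity of cluster graphs -/

namespace Network

/-- The cluster graphs of radius `R` have density at most `f R`: if `Q` is a graph whose edges
join adjacent clusters, and `s` is its set of non-isolated vertices, then `Q` has at most
`f R * |s|` edges, counted as ordered pairs. -/
def DensityBound (N : Network) (f : ℕ → ℕ) : Prop :=
  ∀ (R : ℕ) (κ : ℕ → ℕ), (∀ v, ReachIn N.G {z | κ z = κ v} R v (κ v)) →
    ∀ Q : ℕ → ℕ → Prop, (∀ X Y, Q X Y → Q Y X) →
      (∀ X Y, Q X Y → X ≠ Y ∧ ∃ u v, N.G.Adj u v ∧ κ u = X ∧ κ v = Y) →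
      ∀ s : Finset ℕ, (∀ X, X ∈ s ↔ ∃ Y, Q X Y) →
        {e : ℕ × ℕ | Q e.1 e.2}.ncard ≤ 2 * f R * s.card

lemma edist_induce_le {n : ℕ} {G : SimpleGraph (Fin n)} {ids : Fin n → ℕ}
    (h : Function.Injective ids) {S : Set ℕ} {x y : ℕ} (p : (ofIds G ids h).G.Walk x y)
    (hp : ∀ z ∈ p.support, z ∈ S) :
    ∀ (u v : ((⊤ : G.Subgraph).induce {w | ids w ∈ S}).verts), ids u = x → ids v = y →
      ((⊤ : G.Subgraph).induce {w | ids w ∈ S}).coe.edist u v ≤ p.length := by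
  induction p with
  | nil =>
    intro u v hu hv
    obtain rfl : u = v := Subtype.ext (h (hu.trans hv.symm))
    simp
  | @cons x z y hxz p ih =>
    intro u v hu hv
    obtain ⟨u', w, hadj, hu', rfl⟩ := ofIds_adj.1 hxz
    obtain rfl : u' = u := h (hu'.trans hu.symm)
    have hw : ids w ∈ S := hp _ (by simp)
    let w' : ((⊤ : G.Subgraph).induce {w | ids w ∈ S}).verts := ⟨w, hw⟩
    have h1 := ih (fun z hz => hp z (by simp [hz])) w' v rfl hv
    have hadj' : ((⊤ : G.Subgraph).induce {w | ids w ∈ S}).coe.Adj u w' :=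
      ⟨u.2, hw, hadj⟩
    have h2 := SimpleGraph.edist_le hadj'.toWalk
    refine (SimpleGraph.edist_triangle (v := w')).trans ?_
    rw [SimpleGraph.Walk.length_cons, Nat.cast_add, add_comm]
    exact add_le_add h1 (by simpa using h2)

/-- A bound for the density of shallow minors bounds the density of cluster graphs. -/
theorem densityBound_ofIds {n : ℕ} {G : SimpleGraph (Fin n)} {ids : Fin n → ℕ}
    (h : Function.Injective ids) {f : ℕ → ℕ}
    (hf : ∀ r, shallowDensity r G ≤ (f r : ℝ≥0∞)) : (ofIds G ids h).DensityBound f := by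
  classical
  intro R κ hκ Q hsymm hQ s hs
  let e := s.equivFin
  let H : SimpleGraph (Fin s.card) :=
    { Adj := fun i j => Q (e.symm i) (e.symm j)
      symm := ⟨fun _ _ hij => hsymm _ _ hij⟩
      loopless := ⟨fun _ hi => (hQ _ _ hi).1 rfl⟩ }
  have hminor : IsShallowMinor R H G := by
    refine ⟨fun i => (⊤ : G.Subgraph).induce {v | ids v ∈ {z | κ z = e.symm i}}, ?_, ?_, ?_⟩
    · intro i j hij
      refine Set.disjoint_left.2 fun v hv hv' => hij ?_
      have hvi : κ (ids v) = e.symm i := hv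
      have hvj : κ (ids v) = e.symm j := hv'
      exact e.symm.injective (Subtype.ext (hvi.symm.trans hvj))
    · intro i
      obtain ⟨Y, hY⟩ := (hs _).1 (e.symm i).2
      obtain ⟨-, u, u', huv, hu, -⟩ := hQ _ _ hY
      have hc : κ (e.symm i) = e.symm i := by
        have := (hκ u).right_mem
        rw [hu] at this
        exact this
      have hmem : (e.symm i : ℕ) ∈ (ofIds G ids h).V := by
        have := hκ u
        rw [hu] at this
        exact Near.mem (this.mono le_rfl (Set.subset_univ _)) (mem_of_adj _ huv)
      obtain ⟨c, hcc⟩ := mem_ofIds.1 hmem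
      refine (SimpleGraph.radius_le_eccent (u := ⟨c, by
        change κ (ids c) = _
        rw [hcc, hc]⟩)).trans ((SimpleGraph.eccent_le_iff _ _).2 fun v => ?_)
      have hv : κ (ids v) = e.symm i := v.2
      have hreach := (hκ (ids v)).symm
      rw [hv] at hreach
      obtain ⟨p, hp, hps⟩ := hreach
      refine (edist_induce_le h p hps _ v hcc rfl).trans ?_
      exact_mod_cast hp
    · intro i j hij
      obtain ⟨-, u, v, huv, hu, hv⟩ := hQ _ _ hij
      obtain ⟨u', v', hadj, rfl, rfl⟩ := ofIds_adj.1 huv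
      exact ⟨u', hu, v', hv, hadj⟩
  have hdens : (H.edgeSet.ncard : ℝ≥0∞) / (s.card : ℝ≥0∞) ≤ (f R : ℝ≥0∞) := by
    refine le_trans ?_ (hf R)
    exact le_iSup_of_le s.card (le_iSup_of_le H (le_iSup_of_le hminor le_rfl))
  have hedges : H.edgeFinset.card ≤ f R * s.card := by
    rcases Nat.eq_zero_or_pos s.card with h0 | h0
    · have : IsEmpty (Fin s.card) := by rw [h0]; infer_instance
      have : H.edgeFinset = ∅ := by
        ext x
        induction x with
        | _ a b => exact this.elim a
      simp [this]
    · rw [ENNReal.div_le_iff (by exact_mod_cast h0.ne') (ENNReal.natCast_ne_top _)] at hdens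
      rw [← SimpleGraph.coe_edgeFinset, Set.ncard_coe_finset] at hdens
      exact_mod_cast hdens
  have hsub : {e : ℕ × ℕ | Q e.1 e.2} ⊆
      ((Finset.univ : Finset H.Dart).image fun d => ((e.symm d.fst : ℕ), (e.symm d.snd : ℕ)) :
        Finset (ℕ × ℕ)) := by
    rintro ⟨X, Y⟩ hXY
    have hX : X ∈ s := (hs X).2 ⟨Y, hXY⟩
    have hY : Y ∈ s := (hs Y).2 ⟨X, hsymm _ _ hXY⟩
    have hadj : H.Adj (e ⟨X, hX⟩) (e ⟨Y, hY⟩) := by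
      change Q (e.symm (e ⟨X, hX⟩)) (e.symm (e ⟨Y, hY⟩))
      simpa using hXY
    simp only [Finset.coe_image, Finset.coe_univ, Set.image_univ, Set.mem_range]
    exact ⟨⟨(_, _), hadj⟩, by simp⟩
  calc {e : ℕ × ℕ | Q e.1 e.2}.ncard ≤ _ :=
        (Set.ncard_le_ncard hsub (Finset.finite_toSet _)).trans_eq (Set.ncard_coe_finset _)
    _ ≤ Fintype.card H.Dart := Finset.card_image_le
    _ = 2 * H.edgeFinset.card := H.dart_card_eq_twice_card_edges
    _ ≤ 2 * f R * s.card := by rw [mul_assoc]; exact Nat.mul_le_mul_left 2 hedges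

/-! ### Decrease of the number of links between clusters -/

/-- The ordered pairs of adjacent cells of `κ₀` in different clusters of `κ`. -/
def crossing (N : Network) (κ₀ κ : ℕ → ℕ) : Set (ℕ × ℕ) :=
  {e | ∃ u v, N.G.Adj u v ∧ κ u ≠ κ v ∧ e = (κ₀ u, κ₀ v)}

variable {N : Network} {κ₀ κ : ℕ → ℕ} {R : ℕ} {f : ℕ → ℕ}

lemma crossing_finite : (N.crossing κ₀ κ).Finite := by
  refine ((N.V ×ˢ N.V).finite_toSet.image fun e => (κ₀ e.1, κ₀ e.2)).subset ?_
  rintro e ⟨u, v, huv, -, rfl⟩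
  exact ⟨(u, v), by simp [N.mem_of_adj huv, N.mem_of_adj' huv], rfl⟩

lemma links_subset_crossing {X Y : ℕ} : N.links κ₀ κ X Y ⊆ N.crossing κ₀ κ := by
  rintro e ⟨hne, u, v, huv, rfl, rfl, rfl⟩
  exact ⟨u, v, huv, hne, rfl⟩

lemma links_finite {X Y : ℕ} : (N.links κ₀ κ X Y).Finite :=
  crossing_finite.subset links_subset_crossing

lemma weight_pos_iff {X Y : ℕ} :
    0 < N.weight κ₀ κ X Y ↔ X ≠ Y ∧ ∃ u v, N.G.Adj u v ∧ κ u = X ∧ κ v = Y := by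
  rw [weight, Set.ncard_pos links_finite]
  constructor
  · rintro ⟨e, hne, u, v, huv, hu, hv, -⟩
    exact ⟨hne, u, v, huv, hu, hv⟩
  · rintro ⟨hne, u, v, huv, hu, hv⟩
    exact ⟨_, hne, u, v, huv, hu, hv, rfl⟩

lemma weight_comm (X Y : ℕ) : N.weight κ₀ κ X Y = N.weight κ₀ κ Y X := by
  have hle : ∀ X Y, N.weight κ₀ κ X Y ≤ N.weight κ₀ κ Y X := by
    intro X Y
    rw [weight, ← Set.ncard_image_of_injective _ Prod.swap_injective]
    refine Set.ncard_le_ncard ?_ links_finite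
    rintro _ ⟨e, ⟨hne, u, v, huv, hu, hv, rfl⟩, rfl⟩
    exact ⟨hne.symm, v, u, huv.symm, hv, hu, rfl⟩
  exact (hle X Y).antisymm (hle Y X)

lemma le_heaviest {X : ℕ} {g : ℕ → ℕ} {s : Finset ℕ} (hs : ∀ Y, 0 < g Y → Y ∈ s) (Z : ℕ) :
    g Z ≤ g (heaviest X g) := by
  unfold heaviest
  split_ifs with h
  · exact h.choose_spec.2 Z
  · by_contra! hZ
    have hZ0 : 0 < g Z := by omega
    obtain ⟨Y, -, hY⟩ := s.exists_max_image g ⟨Z, hs Z hZ0⟩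
    have hYmax : ∀ W, g W ≤ g Y := fun W => by
      rcases Nat.eq_zero_or_pos (g W) with h0 | h0
      · omega
      · exact hY W (hs W h0)
    exact h ⟨Y, hZ0.trans_le (hYmax Z), hYmax⟩

namespace IsClustering

lemma mem_of_weight_pos (h : N.IsClustering κ₀ κ R) {X Y : ℕ} (hw : 0 < N.weight κ₀ κ X Y) :
    X ∈ N.V ∧ Y ∈ N.V := by
  obtain ⟨-, u, v, huv, rfl, rfl⟩ := weight_pos_iff.1 hw
  exact ⟨(h.near u).mem (N.mem_of_adj huv), (h.near v).mem (N.mem_of_adj' huv)⟩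

lemma weight_le_partner (h : N.IsClustering κ₀ κ R) (X Y : ℕ) :
    N.weight κ₀ κ X Y ≤ N.weight κ₀ κ X (N.partner κ₀ κ X) :=
  le_heaviest (fun _ hY => (h.mem_of_weight_pos hY).2) Y

/-- For every threshold `θ`, the pairs of weight more than `θ` form a sparse graph. Summation over
`θ` bounds the total weight in terms of the largest weights at the single clusters. -/
lemma sum_weight_le (h : N.IsClustering κ₀ κ R) (hN : N.DensityBound f) :
    ∑ e ∈ N.V ×ˢ N.V, N.weight κ₀ κ e.1 e.2 ≤
      2 * f R * ∑ X ∈ N.V, N.weight κ₀ κ X (N.partner κ₀ κ X) := by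
  set w := N.weight κ₀ κ with hw
  set p := N.partner κ₀ κ with hp
  set B := N.V.sup fun X => w X (p X) with hB
  have hcount : ∀ {m : ℕ}, m ≤ B → m = ∑ θ ∈ Finset.range B, if θ < m then 1 else 0 := by
    intro m hm
    rw [← Finset.card_filter]
    have : {θ ∈ Finset.range B | θ < m} = Finset.range m := by
      ext θ
      simp only [Finset.mem_filter, Finset.mem_range]
      omega
    rw [this, Finset.card_range]
  have hBX : ∀ X ∈ N.V, w X (p X) ≤ B := fun X hX =>
    Finset.le_sup (f := fun X => w X (p X)) hX
  have hlevel : ∀ θ : ℕ, ({e ∈ N.V ×ˢ N.V | θ < w e.1 e.2}).card ≤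
      2 * f R * ({X ∈ N.V | θ < w X (p X)}).card := by
    intro θ
    have key := hN R κ h.reach (fun X Y => θ < w X Y)
      (fun X Y hXY => by rw [hw, weight_comm]; exact hXY)
      (fun X Y hXY => weight_pos_iff.1 (Nat.zero_lt_of_lt hXY)) {X ∈ N.V | θ < w X (p X)}
      (fun X => by
        rw [Finset.mem_filter]
        exact ⟨fun hX => ⟨_, hX.2⟩, fun ⟨Y, hY⟩ =>
          ⟨(h.mem_of_weight_pos (Nat.zero_lt_of_lt hY)).1, hY.trans_le (h.weight_le_partner X Y)⟩⟩)
    refine le_trans (le_of_eq ?_) key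
    rw [← Set.ncard_coe_finset]
    congr 1
    ext e
    simp only [Finset.coe_filter, Finset.mem_product, Set.mem_ofPred_eq]
    exact ⟨fun he => he.2, fun he => ⟨h.mem_of_weight_pos (Nat.zero_lt_of_lt he), he⟩⟩
  calc ∑ e ∈ N.V ×ˢ N.V, w e.1 e.2
      = ∑ e ∈ N.V ×ˢ N.V, ∑ θ ∈ Finset.range B, if θ < w e.1 e.2 then 1 else 0 :=
        Finset.sum_congr rfl fun e he => hcount <|
          (h.weight_le_partner e.1 e.2).trans (hBX _ (Finset.mem_product.1 he).1)
    _ = ∑ θ ∈ Finset.range B, ({e ∈ N.V ×ˢ N.V | θ < w e.1 e.2}).card := by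
        rw [Finset.sum_comm]
        simp only [Finset.card_filter]
    _ ≤ ∑ θ ∈ Finset.range B, 2 * f R * ({X ∈ N.V | θ < w X (p X)}).card :=
        Finset.sum_le_sum fun θ _ => hlevel θ
    _ = 2 * f R * ∑ X ∈ N.V, ∑ θ ∈ Finset.range B, if θ < w X (p X) then 1 else 0 := by
        rw [← Finset.mul_sum, Finset.sum_comm]
        simp only [Finset.card_filter]
    _ = 2 * f R * ∑ X ∈ N.V, w X (p X) := by
        congr 1
        exact Finset.sum_congr rfl fun X hX => (hcount (hBX X hX)).symm

lemma ncard_crossing_le (h : N.IsClustering κ₀ κ R) :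
    (N.crossing κ₀ κ).ncard ≤ ∑ e ∈ N.V ×ˢ N.V, N.weight κ₀ κ e.1 e.2 := by
  classical
  rw [Set.ncard_eq_toFinset_card _ crossing_finite,
    Finset.card_eq_sum_card_fiberwise (f := fun e => (κ e.1, κ e.2)) (t := N.V ×ˢ N.V)]
  · refine Finset.sum_le_sum fun e _ => ?_
    rw [weight, ← Set.ncard_coe_finset]
    refine Set.ncard_le_ncard ?_ links_finite
    rintro a ha
    simp only [Finset.coe_filter, Set.Finite.mem_toFinset, Set.mem_ofPred_eq] at ha
    obtain ⟨⟨u, v, huv, hne, rfl⟩, rfl⟩ := ha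
    simp only [h.factor]
    exact ⟨hne, u, v, huv, rfl, rfl, rfl⟩
  · intro e he
    obtain ⟨u, v, huv, -, rfl⟩ := (Set.Finite.mem_toFinset _).1 he
    simp only [h.factor, Finset.coe_product, Set.mem_prod, Finset.mem_coe]
    exact ⟨(h.near u).mem (N.mem_of_adj huv), (h.near v).mem (N.mem_of_adj' huv)⟩

lemma ncard_crossing_mergeStars_add_le (h : N.IsClustering κ₀ κ R)
    [DecidablePred (N.IsStarCentre κ₀ κ)] :
    (N.crossing κ₀ (N.mergeStars κ₀ κ)).ncard +
      ∑ X ∈ N.V with ¬ N.IsStarCentre κ₀ κ X ∧ N.IsStarCentre κ₀ κ (N.partner κ₀ κ X),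
        N.weight κ₀ κ X (N.partner κ₀ κ X) ≤ (N.crossing κ₀ κ).ncard := by
  classical
  set p := N.partner κ₀ κ with hp
  set A := {X ∈ N.V | ¬ N.IsStarCentre κ₀ κ X ∧ N.IsStarCentre κ₀ κ (p X)} with hA
  set C := (crossing_finite (N := N) (κ₀ := κ₀) (κ := κ)).toFinset with hC
  set M := {e ∈ C | κ e.1 ∈ A ∧ κ e.2 = p (κ e.1)} with hM
  have hsum : ∑ X ∈ A, N.weight κ₀ κ X (p X) ≤ M.card := by
    rw [Finset.card_eq_sum_card_fiberwise (f := fun e => κ e.1) (t := A)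
      (fun e he => (Finset.mem_filter.1 he).2.1)]
    refine Finset.sum_le_sum fun X hX => ?_
    rw [weight, ← Set.ncard_coe_finset]
    refine Set.ncard_le_ncard (fun e he => ?_) (Finset.finite_toSet _)
    have heC : e ∈ C := (Set.Finite.mem_toFinset _).2 (links_subset_crossing he)
    obtain ⟨hne, u, v, huv, rfl, hv, rfl⟩ := he
    rw [Finset.mem_coe, Finset.mem_filter, hM, Finset.mem_filter]
    refine ⟨⟨heC, ?_, ?_⟩, ?_⟩
    · rwa [h.factor]
    · rw [h.factor, h.factor, hv]
    · exact h.factor u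
  -- The links between a leaf and its star centre disappear.
  have hsub : N.crossing κ₀ (N.mergeStars κ₀ κ) ⊆ ((C \ M : Finset (ℕ × ℕ)) : Set (ℕ × ℕ)) := by
    rintro e ⟨u, v, huv, hne, rfl⟩
    have hne' : κ u ≠ κ v := fun he => hne (by rw [Network.mergeStars, Network.mergeStars, he])
    rw [Finset.mem_coe, Finset.mem_sdiff]
    refine ⟨(Set.Finite.mem_toFinset _).2 ⟨u, v, huv, hne', rfl⟩, fun hm => hne ?_⟩
    obtain ⟨-, hu, hv⟩ := Finset.mem_filter.1 hm
    simp only [h.factor] at hu hv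
    have hu' := (Finset.mem_filter.1 hu).2
    have h1 : N.mergeTarget κ₀ κ (κ u) = p (κ u) := if_pos hu'
    rw [Network.mergeStars, Network.mergeStars, h1, hv]
    exact (mergeTarget_partner hu'.2).symm
  have h1 : (N.crossing κ₀ (N.mergeStars κ₀ κ)).ncard ≤ (C \ M).card := by
    rw [← Set.ncard_coe_finset]
    exact Set.ncard_le_ncard hsub (Finset.finite_toSet _)
  have h2 : (C \ M).card + M.card = C.card :=
    Finset.card_sdiff_add_card_eq_card (Finset.filter_subset _ _)
  have h3 : (N.crossing κ₀ κ).ncard = C.card := Set.ncard_eq_toFinset_card _ _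
  omega

/-- A merging step removes a fraction of at least `1 / (8 * f R)` of the links. -/
theorem ncard_crossing_mergeStars (h : N.IsClustering κ₀ κ R) (hN : N.DensityBound f) :
    8 * f R * (N.crossing κ₀ (N.mergeStars κ₀ κ)).ncard + (N.crossing κ₀ κ).ncard ≤
      8 * f R * (N.crossing κ₀ κ).ncard := by
  classical
  have h1 := h.ncard_crossing_mergeStars_add_le
  have h2 := sum_le_four_mul_sum_leaves (V := N.V) (p := N.partner κ₀ κ)
    (g := fun X => N.weight κ₀ κ X (N.partner κ₀ κ X)) (col := forestColor (N.partner κ₀ κ))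
    (fun X hX => (h.near_partner X).mem hX)
    (fun X hX => by
      by_contra h0
      exact (weight_pos_iff.1 (Nat.pos_of_ne_zero h0)).1 hX.symm)
    (fun X hX => forestColor_ne _ hX)
  have h3 := h.ncard_crossing_le.trans (h.sum_weight_le hN)
  change _ ≤ 4 * ∑ X ∈ N.V with ¬ N.IsStarCentre κ₀ κ X ∧
    N.IsStarCentre κ₀ κ (N.partner κ₀ κ X), N.weight κ₀ κ X (N.partner κ₀ κ X) at h2
  calc _ ≤ 8 * f R * (N.crossing κ₀ (N.mergeStars κ₀ κ)).ncard +
        2 * f R * (4 * ∑ X ∈ N.V with ¬ N.IsStarCentre κ₀ κ X ∧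
          N.IsStarCentre κ₀ κ (N.partner κ₀ κ X), N.weight κ₀ κ X (N.partner κ₀ κ X)) :=
        Nat.add_le_add_left (h3.trans (Nat.mul_le_mul_left _ h2)) _
    _ = 8 * f R * ((N.crossing κ₀ (N.mergeStars κ₀ κ)).ncard +
        ∑ X ∈ N.V with ¬ N.IsStarCentre κ₀ κ X ∧
          N.IsStarCentre κ₀ κ (N.partner κ₀ κ X), N.weight κ₀ κ X (N.partner κ₀ κ X)) := by ring
    _ ≤ _ := Nat.mul_le_mul_left _ h1

end IsClustering

end Network

/-! ### Cells of a dominating set and iterated merging -/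

namespace Network

open Classical in
/-- The centre of the cell of `v`, for a dominating set `D`: the vertex `v` itself if it belongs to
`D`, and its neighbour in `D` with the least identifier otherwise. -/
noncomputable def cellCentre (D : ℕ → Prop) (N : Network) (v : ℕ) : ℕ :=
  if D v then v
  else if ∃ u, N.G.Adj v u ∧ D u then sInf {u | N.G.Adj v u ∧ D u}
  else v

section Cells

variable {D : ℕ → Prop} {N : Network}

lemma cellCentre_of_mem {v : ℕ} (h : D v) : cellCentre D N v = v := if_pos h

lemma cellCentre_of_adj {v : ℕ} (h : ¬ D v) (h' : ∃ u, N.G.Adj v u ∧ D u) :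
    N.G.Adj v (cellCentre D N v) ∧ D (cellCentre D N v) := by
  rw [cellCentre, if_neg h, if_pos h']
  exact Nat.sInf_mem (s := {u | N.G.Adj v u ∧ D u}) h'

lemma cellCentre_eq_or_adj (v : ℕ) :
    cellCentre D N v = v ∨ N.G.Adj v (cellCentre D N v) := by
  by_cases h : D v
  · exact .inl (cellCentre_of_mem h)
  · by_cases h' : ∃ u, N.G.Adj v u ∧ D u
    · exact .inr (cellCentre_of_adj h h').1
    · exact .inl (by rw [cellCentre, if_neg h, if_neg h'])

lemma cellCentre_idem (v : ℕ) : cellCentre D N (cellCentre D N v) = cellCentre D N v := by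
  by_cases h : D v
  · rw [cellCentre_of_mem h, cellCentre_of_mem h]
  · by_cases h' : ∃ u, N.G.Adj v u ∧ D u
    · exact cellCentre_of_mem (cellCentre_of_adj h h').2
    · have : cellCentre D N v = v := by rw [cellCentre, if_neg h, if_neg h']
      rw [this, this]

lemma isClustering_cellCentre :
    N.IsClustering (cellCentre D N) (cellCentre D N) 1 where
  factor := cellCentre_idem
  reach v := by
    rcases cellCentre_eq_or_adj (D := D) (N := N) v with h | h
    · exact (congrArg (ReachIn N.G {z | cellCentre D N z = cellCentre D N v} 1 v) h).mpr
        (.refl (S := {z | cellCentre D N z = cellCentre D N v}) rfl 1)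
    · exact .of_adj h rfl (cellCentre_idem v)

end Cells

/-- The radius of the clusters after `i` merging steps. -/
def clusterRadius : ℕ → ℕ
  | 0 => 1
  | i + 1 => 3 * clusterRadius i + 1

/-- The clustering after `i` merging steps that start from the cells of `D`. -/
noncomputable def cluster (D : ℕ → Prop) (N : Network) : ℕ → ℕ → ℕ
  | 0 => cellCentre D N
  | i + 1 => N.mergeStars (cellCentre D N) (cluster D N i)

lemma isClustering_cluster (D : ℕ → Prop) (N : Network) (i : ℕ) :
    N.IsClustering (cellCentre D N) (cluster D N i) (clusterRadius i) := by
  induction i with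
  | zero => exact isClustering_cellCentre
  | succ i ih => exact ih.mergeStars

/-- The cost of `i` merging steps. -/
def mergeCost : ℕ → ℕ
  | 0 => 0
  | i + 1 => mergeCost i + 18 * (2 * clusterRadius i + 1)

variable {N : Network} {D : Network → ℕ → Prop} {T : ℕ}

lemma localAt_cellCentre (hD : N.LocalAt T D) :
    N.LocalAt (T + 1) fun M => cellCentre (D M) M := by
  classical
  intro N' v hv
  have h1 : D N v ↔ D N' v := iff_of_eq (hD N' v (hv.mono (by omega)))
  have h2 : ∀ u, N.G.Adj v u ∧ D N u ↔ N'.G.Adj v u ∧ D N' u := fun u => by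
    rw [← hv.adj_iff]
    exact and_congr_right fun hu => iff_of_eq (hD N' u (hv.of_adj hu))
  have hset : {u | N.G.Adj v u ∧ D N u} = {u | N'.G.Adj v u ∧ D N' u} := Set.ext h2
  exact if_congr h1 rfl (if_congr (exists_congr h2) (congrArg sInf hset) rfl)

lemma localAt_cluster (hD : N.LocalAt T D) {L : ℕ} (hL : ∀ x ∈ N.V, logStar x ≤ L) (i : ℕ) :
    N.LocalAt (T + 1 + mergeCost i * (L + 1)) fun M => cluster (D M) M i := by
  induction i with
  | zero => exact (localAt_cellCentre hD).mono (by omega)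
  | succ i ih =>
    have := localAt_mergeStars (fun M => isClustering_cluster (D M) M i)
      ((localAt_cellCentre hD).mono (by omega)) ih hL
    refine this.mono (le_of_eq ?_)
    rw [mergeCost]
    ring

/-- Initially, there are at most `2 * f 1` links for each vertex of the dominating set. -/
lemma ncard_crossing_cells_le {D : ℕ → Prop} {f : ℕ → ℕ} (hN : N.DensityBound f) {DF : Finset ℕ}
    (hDF : ∀ x ∈ N.V, D x → x ∈ DF) (hdom : ∀ v ∈ N.V, D v ∨ ∃ u, N.G.Adj v u ∧ D u) :
    (N.crossing (cellCentre D N) (cellCentre D N)).ncard ≤ 2 * f 1 * DF.card := by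
  classical
  set κ := cellCentre D N with hκ
  have hcl : N.IsClustering κ κ 1 := isClustering_cellCentre
  have hmem : ∀ v ∈ N.V, κ v ∈ DF := by
    intro v hv
    refine hDF _ ((hcl.near v).mem hv) ?_
    by_cases h : D v
    · rwa [hκ, cellCentre_of_mem h]
    · exact (cellCentre_of_adj h ((hdom v hv).resolve_left h)).2
  have key := hN 1 κ hcl.reach (fun X Y => 0 < N.weight κ κ X Y)
    (fun X Y h => by rw [weight_comm]; exact h) (fun X Y h => weight_pos_iff.1 h)
    {X ∈ N.V | ∃ Y, 0 < N.weight κ κ X Y} (fun X => by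
      rw [Finset.mem_filter]
      exact ⟨fun h => h.2, fun ⟨Y, hY⟩ => ⟨(hcl.mem_of_weight_pos hY).1, Y, hY⟩⟩)
  have hset : N.crossing κ κ = {e : ℕ × ℕ | 0 < N.weight κ κ e.1 e.2} := by
    ext ⟨X, Y⟩
    simp only [crossing, Set.mem_ofPred_eq, weight_pos_iff, Prod.mk.injEq]
    constructor
    · rintro ⟨u, v, huv, hne, rfl, rfl⟩
      exact ⟨hne, u, v, huv, rfl, rfl⟩
    · rintro ⟨hne, u, v, huv, rfl, rfl⟩
      exact ⟨u, v, huv, hne, rfl, rfl⟩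
  rw [hset]
  refine key.trans (Nat.mul_le_mul_left _ (Finset.card_le_card fun X hX => ?_))
  obtain ⟨-, Y, hY⟩ := Finset.mem_filter.1 hX
  obtain ⟨-, u, v, huv, rfl, -⟩ := weight_pos_iff.1 hY
  exact hmem u (N.mem_of_adj huv)

lemma ncard_crossing_cluster_le {D : ℕ → Prop} {f : ℕ → ℕ} (hN : N.DensityBound f)
    (hf : ∀ r, 1 ≤ f r) (i : ℕ) :
    ((N.crossing (cellCentre D N) (cluster D N i)).ncard : ℝ) ≤
      (∏ j ∈ Finset.range i, (1 - 1 / (8 * (f (clusterRadius j) : ℝ)))) *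
        (N.crossing (cellCentre D N) (cellCentre D N)).ncard := by
  induction i with
  | zero => simp [cluster]
  | succ i ih =>
    have hstep := (isClustering_cluster D N i).ncard_crossing_mergeStars hN
    have hpos : (1 : ℝ) ≤ f (clusterRadius i) := by exact_mod_cast hf _
    have hstep' : 8 * (f (clusterRadius i) : ℝ) *
        (N.crossing (cellCentre D N) (cluster D N (i + 1))).ncard +
        (N.crossing (cellCentre D N) (cluster D N i)).ncard ≤
        8 * (f (clusterRadius i) : ℝ) *
          (N.crossing (cellCentre D N) (cluster D N i)).ncard := by
      exact_mod_cast hstep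
    set a : ℝ := ((N.crossing (cellCentre D N) (cluster D N (i + 1))).ncard : ℝ)
    set b : ℝ := ((N.crossing (cellCentre D N) (cluster D N i)).ncard : ℝ)
    set F : ℝ := 8 * (f (clusterRadius i) : ℝ) with hF
    have hFpos : 1 ≤ F := by rw [hF]; linarith
    have hF0 : 0 < F := by linarith
    have hab : a ≤ (1 - 1 / F) * b := by
      rw [sub_mul, one_mul, le_sub_iff_add_le]
      have : F * (a + 1 / F * b) ≤ F * b := by
        have : F * (a + 1 / F * b) = F * a + b := by field_simp
        linarith
      exact le_of_mul_le_mul_left this hF0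
    have h1 : 0 ≤ 1 - 1 / F := by
      rw [sub_nonneg, div_le_one hF0]
      exact hFpos
    rw [Finset.prod_range_succ]
    calc a ≤ (1 - 1 / F) * b := hab
      _ ≤ (1 - 1 / F) * _ := mul_le_mul_of_nonneg_left ih h1
      _ = _ := by ring

/-! ### Optimal domination of the clusters -/

open Classical in
/-- A smallest finite set that meets all members of `𝒮`. -/
noncomputable def minHittingSet (𝒮 : Set (Set ℕ)) : Finset ℕ :=
  if h : ∃ S : Finset ℕ, (∀ s ∈ 𝒮, ∃ u ∈ S, u ∈ s) ∧
      ∀ S' : Finset ℕ, (∀ s ∈ 𝒮, ∃ u ∈ S', u ∈ s) → S.card ≤ S'.card then h.choose else ∅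

lemma minHittingSet_spec {𝒮 : Set (Set ℕ)} {S₀ : Finset ℕ} (h₀ : ∀ s ∈ 𝒮, ∃ u ∈ S₀, u ∈ s) :
    (∀ s ∈ 𝒮, ∃ u ∈ minHittingSet 𝒮, u ∈ s) ∧ (minHittingSet 𝒮).card ≤ S₀.card := by
  classical
  have hex : ∃ S : Finset ℕ, (∀ s ∈ 𝒮, ∃ u ∈ S, u ∈ s) ∧
      ∀ S' : Finset ℕ, (∀ s ∈ 𝒮, ∃ u ∈ S', u ∈ s) → S.card ≤ S'.card := by
    have hm : ∃ m, ∃ S : Finset ℕ, (∀ s ∈ 𝒮, ∃ u ∈ S, u ∈ s) ∧ S.card = m := ⟨_, S₀, h₀, rfl⟩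
    obtain ⟨S, hS, hc⟩ := Nat.find_spec hm
    exact ⟨S, hS, fun S' hS' => hc.trans_le (Nat.find_min' hm ⟨S', hS', rfl⟩)⟩
  rw [minHittingSet, dif_pos hex]
  exact ⟨hex.choose_spec.1, hex.choose_spec.2 S₀ h₀⟩

/-- The closed neighbourhoods of the vertices in the cluster `X`. -/
def clusterNbhds (N : Network) (κ : ℕ → ℕ) (X : ℕ) : Set (Set ℕ) :=
  (fun v => {u | u = v ∨ N.G.Adj v u}) '' {v | v ∈ N.V ∧ κ v = X}

/-- The vertices chosen by some cluster, when each cluster is dominated by as few vertices of the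
network as possible. -/
def ClusterwiseDominating (N : Network) (κ : ℕ → ℕ) (x : ℕ) : Prop :=
  ∃ v ∈ N.V, (x = v ∨ N.G.Adj v x) ∧ x ∈ minHittingSet (N.clusterNbhds κ (κ v))

lemma localAt_clusterwiseDominating {K₀ K : Network → ℕ → ℕ} {R : ℕ}
    (hK : ∀ M, IsClustering M (K₀ M) (K M) R) (h : N.LocalAt T K) :
    N.LocalAt (T + 2 * R + 2) fun M => ClusterwiseDominating M (K M) := by
  have hnbhds : ∀ {M M' : Network}, (∀ y, Agree M M' T y → K M y = K M' y) → ∀ {X : ℕ},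
      Agree M M' (T + R + 1) X → M.clusterNbhds (K M) X ⊆ M'.clusterNbhds (K M') X := by
    rintro M M' h X hX _ ⟨v, ⟨hv, rfl⟩, rfl⟩
    have hva := hX.near (r := T + 1) ((hK M).near v).symm (by omega)
    refine ⟨v, ⟨hva.symm.mem, (h v (hva.mono (by omega))).symm⟩, ?_⟩
    ext u
    exact or_congr_right (hva.adj_iff u).symm
  have key : ∀ {M M' : Network}, (∀ y, Agree M M' T y → K M y = K M' y) → ∀ {x : ℕ},
      Agree M M' (T + 2 * R + 2) x → ClusterwiseDominating M (K M) x →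
      ClusterwiseDominating M' (K M') x := by
    rintro M M' h x hx ⟨v, hv, hxv, hmem⟩
    have hnear : M.Near 1 x v := by
      rcases hxv with rfl | hxv
      · exact near_refl _ _ _
      · exact near_of_adj hxv.symm
    have hva := hx.near (r := T + 2 * R + 1) hnear (by omega)
    have hX := hva.near (r := T + R + 1) ((hK M).near v) (by omega)
    have hKv := h v (hva.mono (by omega))
    refine ⟨v, hva.symm.mem, hxv.imp id fun hadj => (hva.adj_iff x).1 hadj, ?_⟩
    have hset : M.clusterNbhds (K M) (K M v) = M'.clusterNbhds (K M') (K M v) :=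
      (hnbhds h hX).antisymm (hnbhds (fun y hy => (h y hy.symm).symm) hX.symm)
    rwa [← hKv, ← hset]
  intro N' x hx
  exact propext ⟨key (h N') hx, key (fun y hy => (h N' y hy.symm).symm) hx.symm⟩

variable {κ₀ κ : ℕ → ℕ} {R : ℕ}

/-- The cluster `X` is dominated by its vertices in a given dominating set `O` together with its
cell centres that have links to other clusters. -/
lemma exists_hittingSet (h : N.IsClustering κ₀ κ R)
    (hκ₀ : ∀ v, κ₀ v = v ∨ N.G.Adj v (κ₀ v)) {O C : Finset ℕ}
    (hO : ∀ v ∈ N.V, v ∈ O ∨ ∃ o ∈ O, N.G.Adj v o) (X : ℕ)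
    (hC : ∀ e ∈ N.crossing κ₀ κ, e.1 ∈ C) :
    ∀ s ∈ N.clusterNbhds κ X, ∃ u ∈ {o ∈ O | κ o = X} ∪ {a ∈ C | κ a = X}, u ∈ s := by
  rintro _ ⟨v, ⟨hv, rfl⟩, rfl⟩
  obtain ⟨o, ho, hov⟩ : ∃ o ∈ O, o = v ∨ N.G.Adj v o := by
    rcases hO v hv with h | ⟨o, ho, hvo⟩
    exacts [⟨v, h, .inl rfl⟩, ⟨o, ho, .inr hvo⟩]
  by_cases hκo : κ o = κ v
  · exact ⟨o, Finset.mem_union_left _ (Finset.mem_filter.2 ⟨ho, hκo⟩), hov⟩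
  · have hadj : N.G.Adj v o := hov.resolve_left fun he => hκo (by rw [he])
    have he := hC (κ₀ v, κ₀ o) ⟨v, o, hadj, fun he => hκo he.symm, rfl⟩
    exact ⟨κ₀ v, Finset.mem_union_right _ (Finset.mem_filter.2 ⟨he, h.factor v⟩), hκ₀ v⟩

lemma sum_card_fiber_le (s t : Finset ℕ) (φ : ℕ → ℕ) :
    ∑ X ∈ t, ({a ∈ s | φ a = X}).card ≤ s.card := by
  rw [Finset.sum_card_fiberwise_eq_card_filter]
  exact Finset.card_filter_le _ _

/-- Dominating each cluster optimally costs at most the size of any dominating set `O` plus the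
number of links between clusters. -/
theorem card_clusterwiseDominating_le (h : N.IsClustering κ₀ κ R)
    (hκ₀ : ∀ v, κ₀ v = v ∨ N.G.Adj v (κ₀ v)) {O : Finset ℕ}
    (hO : ∀ v ∈ N.V, v ∈ O ∨ ∃ o ∈ O, N.G.Adj v o) {F : Finset ℕ}
    (hF : ∀ x ∈ F, N.ClusterwiseDominating κ x) :
    F.card ≤ O.card + (N.crossing κ₀ κ).ncard := by
  classical
  set C := (crossing_finite (N := N) (κ₀ := κ₀) (κ := κ)).toFinset.image Prod.fst with hC
  have hCmem : ∀ e ∈ N.crossing κ₀ κ, e.1 ∈ C := fun e he =>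
    Finset.mem_image_of_mem _ ((Set.Finite.mem_toFinset _).2 he)
  have hCcard : C.card ≤ (N.crossing κ₀ κ).ncard := by
    rw [Set.ncard_eq_toFinset_card _ crossing_finite]
    exact Finset.card_image_le
  have hsub : F ⊆ (N.V.image κ).biUnion fun X => minHittingSet (N.clusterNbhds κ X) := by
    intro x hx
    obtain ⟨v, hv, -, hmem⟩ := hF x hx
    exact Finset.mem_biUnion.2 ⟨κ v, Finset.mem_image_of_mem _ hv, hmem⟩
  calc F.card ≤ _ := Finset.card_le_card hsub
    _ ≤ ∑ X ∈ N.V.image κ, (minHittingSet (N.clusterNbhds κ X)).card := Finset.card_biUnion_le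
    _ ≤ ∑ X ∈ N.V.image κ, (({o ∈ O | κ o = X}).card + ({a ∈ C | κ a = X}).card) :=
        Finset.sum_le_sum fun X _ =>
          (minHittingSet_spec (exists_hittingSet h hκ₀ hO X hCmem)).2.trans
            (Finset.card_union_le _ _)
    _ ≤ O.card + C.card := by
        rw [Finset.sum_add_distrib]
        exact add_le_add (sum_card_fiber_le _ _ _) (sum_card_fiber_le _ _ _)
    _ ≤ _ := Nat.add_le_add_left hCcard _

lemma exists_clusterwiseDominating (N : Network) (κ : ℕ → ℕ) {v : ℕ} (hv : v ∈ N.V) :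
    ∃ u, (u = v ∨ N.G.Adj v u) ∧ N.ClusterwiseDominating κ u := by
  have h₀ : ∀ s ∈ N.clusterNbhds κ (κ v), ∃ u ∈ N.V, u ∈ s := by
    rintro _ ⟨w, ⟨hw, -⟩, rfl⟩
    exact ⟨w, hw, .inl rfl⟩
  obtain ⟨u, hu, huv⟩ := (minHittingSet_spec h₀).1 _ ⟨v, ⟨hv, rfl⟩, rfl⟩
  exact ⟨u, huv, v, hv, huv, hu⟩

/-! ### The number of merging steps -/

lemma clusterRadius_le (i : ℕ) : 2 * clusterRadius i + 1 ≤ 3 ^ (i + 1) := by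
  induction i with
  | zero => simp [clusterRadius]
  | succ i ih =>
    rw [clusterRadius, pow_succ]
    omega

lemma lt_clusterRadius (i : ℕ) : i < clusterRadius i := by
  induction i with
  | zero => simp [clusterRadius]
  | succ i ih =>
    rw [clusterRadius]
    omega

/-- As `f (clusterRadius i)` is of order at most `i`, the product is bounded by the exponential of
minus a multiple of the harmonic series. -/
theorem exists_prod_le {f : ℕ → ℕ} (hf : ∀ r, 1 ≤ f r)
    (hlog : (fun r : ℕ => (f r : ℝ)) =o[Filter.atTop] fun r : ℕ => Real.log (r : ℝ))
    {η : ℝ} (hη : 0 < η) :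
    ∃ p : ℕ, ∏ i ∈ Finset.range p, (1 - 1 / (8 * (f (clusterRadius i) : ℝ))) ≤ η := by
  set a : ℕ → ℝ := fun i => 1 / (8 * (f (clusterRadius i) : ℝ)) with ha
  have hfpos : ∀ r, (1 : ℝ) ≤ f r := fun r => by exact_mod_cast hf r
  have hrad : Filter.Tendsto clusterRadius Filter.atTop Filter.atTop :=
    Filter.tendsto_atTop_mono (fun i => (lt_clusterRadius i).le) Filter.tendsto_id
  have hev : ∀ᶠ i in Filter.atTop, 1 / 16 * (1 / ((i + 1 : ℕ) : ℝ)) ≤ a i := by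
    filter_upwards [hrad.eventually (hlog.def one_pos)] with i hi
    have hr0 : (0 : ℝ) < clusterRadius i := by
      exact_mod_cast (Nat.zero_le i).trans_lt (lt_clusterRadius i)
    have hle : (clusterRadius i : ℝ) ≤ 3 ^ (i + 1) := by
      exact_mod_cast (show clusterRadius i ≤ 3 ^ (i + 1) by have := clusterRadius_le i; omega)
    have hlog3 : Real.log 3 ≤ 2 := by
      have := Real.log_le_sub_one_of_pos (x := 3) (by norm_num)
      linarith
    have hlogr : Real.log (clusterRadius i) ≤ (i + 1 : ℕ) * 2 :=
      calc Real.log (clusterRadius i) ≤ Real.log (3 ^ (i + 1)) := Real.log_le_log hr0 hle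
        _ = (i + 1 : ℕ) * Real.log 3 := Real.log_pow _ _
        _ ≤ _ := mul_le_mul_of_nonneg_left hlog3 (Nat.cast_nonneg _)
    have hlog0 : 0 ≤ Real.log (clusterRadius i) := Real.log_natCast_nonneg _
    rw [one_mul, Real.norm_of_nonneg (Nat.cast_nonneg _), Real.norm_of_nonneg hlog0] at hi
    simp only [ha]
    rw [one_div_mul_one_div]
    refine one_div_le_one_div_of_le ?_ ?_
    · have := hfpos (clusterRadius i)
      linarith
    · linarith
  have hns : ¬ Summable a := by
    intro hs
    have h1 : Summable fun i : ℕ => 1 / 16 * (1 / ((i + 1 : ℕ) : ℝ)) := by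
      refine Summable.of_norm_bounded_eventually_nat hs ?_
      filter_upwards [hev] with i hi
      rwa [Real.norm_of_nonneg (by positivity)]
    rw [summable_mul_left_iff (by norm_num)] at h1
    exact Real.not_summable_one_div_natCast
      ((summable_nat_add_iff (f := fun i : ℕ => 1 / (i : ℝ)) 1).1 h1)
  have ha0 : ∀ i, 0 ≤ a i := fun i => by positivity
  have htop := (not_summable_iff_tendsto_nat_atTop_of_nonneg ha0).1 hns
  obtain ⟨p, hp⟩ := (htop.eventually (Filter.eventually_ge_atTop (-Real.log η))).exists
  refine ⟨p, ?_⟩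
  calc ∏ i ∈ Finset.range p, (1 - a i) ≤ ∏ i ∈ Finset.range p, Real.exp (-a i) := by
        refine Finset.prod_le_prod (fun i _ => ?_) fun i _ => Real.one_sub_le_exp_neg _
        rw [sub_nonneg, ha]
        have := hfpos (clusterRadius i)
        exact (div_le_one (by linarith)).2 (by linarith)
    _ = Real.exp (-∑ i ∈ Finset.range p, a i) := by
        rw [← Real.exp_sum, Finset.sum_neg_distrib]
    _ ≤ Real.exp (Real.log η) := Real.exp_le_exp.2 (by linarith)
    _ = η := Real.exp_log hη

end Network

/-! ### The approximation algorithm -/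

lemma exists_minimum_dominatingSet {V : Type*} [Fintype V] (G : SimpleGraph V) :
    ∃ D : Finset V, IsDominatingSet G D ∧ D.card = dominationNumber G :=
  Nat.sInf_mem (s := {s : ℕ | ∃ D : Finset V, IsDominatingSet G D ∧ D.card = s})
    ⟨_, Finset.univ, fun v => .inl (Finset.mem_univ v), rfl⟩

lemma LocalAlgorithm.OutputsWithin.mono {A : LocalAlgorithm} {V : Type*} {G : SimpleGraph V}
    {ids : V → ℕ} {S T : ℕ} {D : Finset V} (h : A.OutputsWithin G ids S D) (hST : S ≤ T) :
    A.OutputsWithin G ids T D := fun v => by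
  obtain ⟨r, hr, h⟩ := h v
  exact ⟨r, hr.trans hST, h⟩

/-- The cost of collecting the information that determines the optimal domination of the clusters
after `p` merging steps, in multiples of `t + log* n + 1`. -/
def roundFactor (k p : ℕ) : ℕ :=
  Network.mergeCost p * (k + 1) + 2 * Network.clusterRadius p + 3

/-- If `p` merging steps reduce the number of links to the fraction `η` of the initial one, then
each `c`-approximation that is computed in `t` rounds can be improved to a
`(1 + 2 * f 1 * c * η)`-approximation. -/
theorem computesApprox_viewAlgorithm {C : GraphClass} {f : ℕ → ℕ} (hf : ∀ r, 1 ≤ f r)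
    (hC : ∀ (n : ℕ) (G : SimpleGraph (Fin n)), G ∈ C n →
      ∀ r : ℕ, shallowDensity r G ≤ (f r : ℝ≥0∞))
    {k p : ℕ} {c η ε : ℝ} (hη : 0 ≤ η)
    (hp : ∏ i ∈ Finset.range p, (1 - 1 / (8 * (f (Network.clusterRadius i) : ℝ))) ≤ η)
    (hε : 2 * f 1 * η * c ≤ ε) {t : (n : ℕ) → SimpleGraph (Fin n) → ℕ} {A : LocalAlgorithm}
    (hA : A.ComputesApprox C k c t) :
    (LocalAlgorithm.viewAlgorithm fun N =>
      N.ClusterwiseDominating (Network.cluster (A.outputSet N) N p)).ComputesApprox C k (1 + ε)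
        fun n G => roundFactor k p * (t n G + logStar n + 1) := by
  classical
  intro n G hG ids hids
  obtain ⟨D, hD, hDdom, hDcard⟩ := hA n G hG ids hids
  obtain ⟨hinj, hrange⟩ := hids
  set N := Network.ofIds G ids hinj with hN
  set κ := Network.cluster (A.outputSet N) N p with hκ
  have hcl := Network.isClustering_cluster (A.outputSet N) N p
  have hDmem := hD.mem_iff hinj
  have hL : ∀ x ∈ N.V, logStar x ≤ logStar n + k := by
    intro x hx
    obtain ⟨v, rfl⟩ := Network.mem_ofIds.1 hx
    exact logStar_le_of_le_pow (hrange v).2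
  have hlocal := Network.localAt_clusterwiseDominating
    (fun M => Network.isClustering_cluster (A.outputSet M) M p)
    (Network.localAt_cluster (hD.localAt hinj) hL p)
  set F : Finset (Fin n) := {v | N.ClusterwiseDominating κ (ids v)} with hF
  have hFmem : ∀ v, v ∈ F ↔ N.ClusterwiseDominating κ (ids v) := fun v => by simp [hF]
  refine ⟨F, (LocalAlgorithm.viewAlgorithm_outputsWithin hinj hlocal hFmem).mono ?_,
    ?_, ?_⟩
  · have h1 : logStar n + k + 1 ≤ (k + 1) * (logStar n + 1) := by nlinarith
    have h2 := Nat.mul_le_mul_left (Network.mergeCost p) h1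
    rw [roundFactor]
    nlinarith [Nat.zero_le (Network.mergeCost p * (k + 1) * t n G),
      Nat.zero_le (Network.clusterRadius p * (t n G + logStar n))]
  · intro v
    obtain ⟨u, huv, hu⟩ := N.exists_clusterwiseDominating κ (v := ids v) (by simp [hN])
    rcases huv with rfl | hadj
    · exact .inl ((hFmem v).2 hu)
    · obtain ⟨u', rfl⟩ := Network.mem_ofIds.1 (N.mem_of_adj' hadj)
      exact .inr ⟨u', (hFmem u').2 hu, (Network.ofIds_adj_ids.1 hadj).symm⟩
  · obtain ⟨O, hOdom, hOcard⟩ := exists_minimum_dominatingSet G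
    have htrans : ∀ {S : Finset (Fin n)}, IsDominatingSet G S → ∀ v ∈ N.V,
        v ∈ S.map ⟨ids, hinj⟩ ∨ ∃ o ∈ S.map ⟨ids, hinj⟩, N.G.Adj v o := by
      intro S hS v hv
      obtain ⟨v, rfl⟩ := Network.mem_ofIds.1 hv
      rcases hS v with h | ⟨u, hu, huv⟩
      · exact .inl (Finset.mem_map_of_mem ⟨ids, hinj⟩ h)
      · exact .inr ⟨ids u, Finset.mem_map_of_mem ⟨ids, hinj⟩ hu,
          Network.ofIds_adj_ids.2 huv.symm⟩
    have hDset : ∀ x ∈ N.V, A.outputSet N x ↔ x ∈ D.map ⟨ids, hinj⟩ := by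
      intro x hx
      obtain ⟨v, rfl⟩ := Network.mem_ofIds.1 hx
      rw [← hDmem v]
      simp
    have hcard := Network.card_clusterwiseDominating_le hcl
      Network.cellCentre_eq_or_adj (htrans hOdom)
      (F := F.map ⟨ids, hinj⟩)
      (fun x hx => by
        obtain ⟨v, hv, rfl⟩ := Finset.mem_map.1 hx
        exact (hFmem v).1 hv)
    rw [Finset.card_map, Finset.card_map, hOcard] at hcard
    have hdens : N.DensityBound f := Network.densityBound_ofIds hinj (hC n G hG)
    have hcells := Network.ncard_crossing_cells_le hdens (D := A.outputSet N)
      (DF := D.map ⟨ids, hinj⟩) (fun x hx hxD => (hDset x hx).1 hxD) (fun v hv => by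
        rcases htrans hDdom v hv with h | ⟨u, hu, huv⟩
        · exact .inl ((hDset v hv).2 h)
        · exact .inr ⟨u, huv, (hDset u (N.mem_of_adj' huv)).2 hu⟩)
    rw [Finset.card_map] at hcells
    have hcells' : ((N.crossing (Network.cellCentre (A.outputSet N) N)
        (Network.cellCentre (A.outputSet N) N)).ncard : ℝ) ≤ 2 * f 1 * D.card := by
      exact_mod_cast hcells
    have hcross := Network.ncard_crossing_cluster_le (D := A.outputSet N) hdens hf p
    have hcard' : (F.card : ℝ) ≤
        dominationNumber G + (N.crossing (Network.cellCentre (A.outputSet N) N) κ).ncard := by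
      exact_mod_cast hcard
    calc _ ≤ _ := hcard'
      _ ≤ dominationNumber G + η * (2 * f 1 * (c * dominationNumber G)) := by
          refine add_le_add le_rfl (hcross.trans ?_)
          refine (mul_le_mul_of_nonneg_right hp (Nat.cast_nonneg _)).trans ?_
          refine mul_le_mul_of_nonneg_left (hcells'.trans ?_) hη
          exact mul_le_mul_of_nonneg_left hDcard (by positivity)
      _ = dominationNumber G + 2 * f 1 * η * c * dominationNumber G := by ring
      _ ≤ dominationNumber G + ε * dominationNumber G :=
          add_le_add le_rfl (mul_le_mul_of_nonneg_right hε (Nat.cast_nonneg _))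
      _ = (1 + ε) * dominationNumber G := by ring

theorem mainTheorem5 (C : GraphClass) (hC : C.SubLogExpansion) (k : ℕ) (hk : 1 ≤ k) :
    ∃ K : ℝ → ℝ → ℕ,
      ∀ (c : ℝ) (t : (n : ℕ) → SimpleGraph (Fin n) → ℕ) (A : LocalAlgorithm),
        A.ComputesApprox C k c t →
        ∃ B : ℝ → LocalAlgorithm, ∀ ε : ℝ, 0 < ε →
          (B ε).ComputesApprox C k (1 + ε)
            (fun n G => K ε c * (t n G + logStar n + 1)) := by
  obtain ⟨f₀, hlog, hdens⟩ := hC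
  set f : ℕ → ℕ := fun r => f₀ r + 1 with hf
  have hf1 : ∀ r, 1 ≤ f r := fun r => Nat.le_add_left 1 (f₀ r)
  have hflog : (fun r : ℕ => (f r : ℝ)) =o[Filter.atTop] fun r : ℕ => Real.log (r : ℝ) := by
    have h1 : (fun _ : ℕ => (1 : ℝ)) =o[Filter.atTop] fun r : ℕ => Real.log (r : ℝ) :=
      (Real.isLittleO_const_log_atTop (c := 1)).comp_tendsto tendsto_natCast_atTop_atTop
    simpa [hf] using hlog.add h1
  have hfdens : ∀ (n : ℕ) (G : SimpleGraph (Fin n)), G ∈ C n →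
      ∀ r : ℕ, shallowDensity r G ≤ (f r : ℝ≥0∞) := fun n G hG r =>
    (hdens n G hG r).trans (by exact_mod_cast Nat.le_succ _)
  have hsteps : ∀ ε c : ℝ, ∃ p : ℕ, 0 < ε →
      ∏ i ∈ Finset.range p, (1 - 1 / (8 * (f (Network.clusterRadius i) : ℝ))) ≤
        ε / (2 * f 1 * max c 1) := by
    intro ε c
    by_cases hε : 0 < ε
    · have hpos : (0 : ℝ) < 2 * f 1 * max c 1 := by
        have : (0 : ℝ) < f 1 := by exact_mod_cast hf1 1
        positivity
      obtain ⟨p, hp⟩ := Network.exists_prod_le hf1 hflog (div_pos hε hpos)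
      exact ⟨p, fun _ => hp⟩
    · exact ⟨0, fun h => absurd h hε⟩
  choose p hp using hsteps
  refine ⟨fun ε c => roundFactor k (p ε c), fun c t A hA =>
    ⟨fun ε => LocalAlgorithm.viewAlgorithm fun N =>
      N.ClusterwiseDominating (Network.cluster (A.outputSet N) N (p ε c)), fun ε hε => ?_⟩⟩
  have hf0 : (0 : ℝ) < f 1 := by exact_mod_cast hf1 1
  have hm : (0 : ℝ) < max c 1 := lt_max_of_lt_right one_pos
  refine computesApprox_viewAlgorithm hf1 hfdens (by positivity) (hp ε c hε) ?_ hA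
  calc 2 * f 1 * (ε / (2 * f 1 * max c 1)) * c ≤
      2 * f 1 * (ε / (2 * f 1 * max c 1)) * max c 1 :=
        mul_le_mul_of_nonneg_left (le_max_left _ _) (by positivity)
    _ = ε := by field_simp
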